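/- **Setting.** Let $\mathcal X$ be a measurable space, $\mathcal H$ a real reproducing kernel Hilbert space of functions on $\mathcal X$ with (jointly measurable) kernel $k$, and $P$ a probability distribution of $(X,Y)$ on $\mathcal X\times\mathbb R$ with marginal $P_X$ and regression function $\bar f(x)=E[Y\mid X=x]$. Assume (B) $Y\in[-1,1]$ almost surely and $\sup_{x}k(x,x)\le 1$; (U) for every probability distribution $Q$ on $\mathcal X$, $\mathcal H$ is dense in $L_2(Q)$. Let $(x_1,y_1),(x_2,y_2),\dots$ be independent with law $P$. From the first $n$ observations form $T^*v=\frac1n\sum_{i=1}^n v_i\,k(x_i,\cdot)$ for $v\in\mathbb R^n$, and $Sg=T^*(g(x_1),\dots,g(x_n))$ for $g\in\mathcal H$, and put $\mathbf y=(y_1,\dots,y_n)$. **Kernel PLS (conjugate gradients).** $g_0=0$, $u_0=d_0=T^*\mathbf y$, and for $m=0,1,\dots$ $$\alpha_m=\frac{\|u_m\|^2}{\langle d_m,Sd_m\rangle},\quad g_{m+1}=g_m+\alpha_md_m,\quad u_{m+1}=u_m-\alpha_mSd_m,\quad \beta_m=\frac{\|u_{m+1}\|^2}{\|u_m\|^2},\quad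 d_{m+1}=u_{m+1}+\beta_md_m .$$ **Error monitoring.** Let $\zeta(x,\delta)=\frac{\delta}{x(x-\delta)}$, defined only for $x>\delta\ge0$; $\xi(x,y,\delta_x,\delta_y)=x\delta_y+y\delta_x+\delta_x\delta_y$; $\xi'(x,y,\delta_x,\delta_y)=x\delta_y+y\delta_x$; $\varepsilon_n=4\sqrt{(\log n)/n}$. Start from $\delta^g_0=0$, $\delta^u_0=\delta^d_0=\varepsilon_n$, $\varepsilon_{0,4}=\xi(\|u_0\|,\|u_0\|,\delta^u_0,\delta^u_0)$. Pass $m=0,1,\dots$ computes $$\begin{aligned} \varepsilon_{m,1}&=\xi'(\|d_m\|,1,\delta^d_m,\varepsilon_n), & \varepsilon_{m,2}&=\xi(\|d_m\|,\|d_m\|,\delta^d_m,\varepsilon_{m,1}),\\ \varepsilon_{m,3}&=\zeta(\langle d_m,Sd_m\rangle,\varepsilon_{m,2}), & \delta^\alpha_m&=\xi(\|u_m\|^2,\langle d_m,Sd_m\rangle^{-1},\varepsilon_{m,4},\varepsilon_{m,3}),\\ \delta^g_{m+1}&=\delta^g_m+\xi(\alpha_m,\|d_m\|,\delta^\alpha_m,\delta^d_m),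 & \delta^u_{m+1}&=\delta^u_m+\xi(\alpha_m,\|d_m\|,\delta^\alpha_m,\varepsilon_{m,1}),\\ \varepsilon_{m,5}&=\zeta(\|u_m\|^2,\varepsilon_{m,4}), & \varepsilon_{m+1,4}&=\xi(\|u_{m+1}\|,\|u_{m+1}\|,\delta^u_{m+1},\delta^u_{m+1}),\\ \delta^\beta_m&=\xi(\|u_{m+1}\|^2,\|u_m\|^{-2},\varepsilon_{m+1,4},\varepsilon_{m,5}), & \delta^d_{m+1}&=\delta^u_{m+1}+\xi(\beta_m,\|d_m\|,\delta^\beta_m,\delta^d_m), \end{aligned}$$ and exits if $\varepsilon_{m,3}$ or $\varepsilon_{m,5}$ is not defined. **Stopping rule.** Fix $0<\gamma<\frac12$. Let $m_{(n)}$ be the least $m\ge0$ such that pass $m$ exits or $\delta^g_{m+1}>n^{-\gamma}$, and let $f^{(n)}=g_{m_{(n)}}$, viewed as an element of $L_2(P_X)$. **Theorem.** Under (B) and (U), almost surely $$\lim_{n\to\infty}\|\bar f-f^{(n)}\|_{L_2(P_X)}=0 .$$ -/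

import Mathlib

open MeasureTheory ProbabilityTheory Filter Topology

noncomputable section

namespace KPLS

/-! ### Kernel, universality and regression function -/

section Kernel

variable {𝒳 : Type*} (H : Type*) [NormedAddCommGroup H] [InnerProductSpace ℝ H]
  [CompleteSpace H] [RKHS ℝ H 𝒳 ℝ]

/-- The feature map `φ(x) = k(x, ·)`, an element of the reproducing kernel Hilbert space `H`. -/
def feature (x : 𝒳) : H := RKHS.kerFun H x (1 : ℝ)

/-- The real-valued reproducing kernel `k(x, x')` of `H`. -/
def ker (x x' : 𝒳) : ℝ := RKHS.kernel H x x' (1 : ℝ)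

/-- Universality: for every probability distribution `Q` on `𝒳`, (the classes of) the functions
of `H` are dense in `L²(Q)`. -/
def IsUniversal [MeasurableSpace 𝒳] : Prop :=
  ∀ Q : Measure 𝒳, IsProbabilityMeasure Q →
    Dense {f : Lp ℝ 2 Q | ∃ g : H, (f : 𝒳 → ℝ) =ᵐ[Q] (g : 𝒳 → ℝ)}

end Kernel

/-- The regression function `x ↦ E[Y | X = x]` of a law `P` of `(X, Y)` on `𝒳 × ℝ`: the mean of
the regular conditional distribution of `Y` given `X = x`. -/
def regression {𝒳 : Type*} [MeasurableSpace 𝒳] (P : Measure (𝒳 × ℝ)) [IsFiniteMeasure P]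
    (x : 𝒳) : ℝ :=
  ∫ y, y ∂(P.condKernel x)

/-! ### Empirical operators -/

section Empirical

variable {𝒳 : Type*} {H : Type*} [NormedAddCommGroup H] [InnerProductSpace ℝ H]
  [CompleteSpace H] [RKHS ℝ H 𝒳 ℝ] {n : ℕ}

/-- The empirical integral operator `T* v = (1/n) ∑ i, v i • k(x i, ·)`. -/
def empAdjoint (x : Fin n → 𝒳) (v : Fin n → ℝ) : H :=
  (n : ℝ)⁻¹ • ∑ i, v i • feature H (x i)

/-- The empirical covariance operator `S = T* T`, where `T g = (g (x 1), …, g (x n))`. -/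
def empCov (x : Fin n → 𝒳) (g : H) : H :=
  empAdjoint x (fun i => g (x i))

end Empirical

/-! ### Kernel PLS: conjugate gradients for `S g = b` -/

section CG

variable {H : Type*} [NormedAddCommGroup H] [InnerProductSpace ℝ H]

/-- The iterate `g`, the residual `u` and the search direction `d`. -/
structure CGState (H : Type*) where
  g : H
  u : H
  d : H

/-- The step size `α = ‖u‖² / ⟨d, S d⟩`. -/
def CGState.α (S : H → H) (s : CGState H) : ℝ :=
  ‖s.u‖ ^ 2 / inner ℝ s.d (S s.d)

/-- The updated residual `u - α S d`. -/
def CGState.nextU (S : H → H) (s : CGState H) : H :=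
  s.u - s.α S • S s.d

/-- The coefficient `β = ‖u_{m+1}‖² / ‖u_m‖²`. -/
def CGState.β (S : H → H) (s : CGState H) : ℝ :=
  ‖s.nextU S‖ ^ 2 / ‖s.u‖ ^ 2

/-- One pass of the conjugate gradient iteration. -/
def CGState.next (S : H → H) (s : CGState H) : CGState H where
  g := s.g + s.α S • s.d
  u := s.nextU S
  d := s.nextU S + s.β S • s.d

/-- The conjugate gradient iteration started from `g = 0`, `u = d = b`. -/
def cg (S : H → H) (b : H) : ℕ → CGState H
  | 0 => ⟨0, b, b⟩
  | m + 1 => (cg S b m).next S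

/-! ### Error monitoring -/

/-- `ζ(x, δ) = δ / (x (x - δ))`. -/
def zeta (x δ : ℝ) : ℝ := δ / (x * (x - δ))

/-- `ζ(x, δ)` is defined only for `x > δ ≥ 0`. -/
def ZetaDefined (x δ : ℝ) : Prop := 0 ≤ δ ∧ δ < x

/-- `ξ(x, y, δx, δy) = x δy + y δx + δx δy`. -/
def xi (x y δx δy : ℝ) : ℝ := x * δy + y * δx + δx * δy

/-- `ξ'(x, y, δx, δy) = x δy + y δx`. -/
def xi' (x y δx δy : ℝ) : ℝ := x * δy + y * δx

/-- `εₙ = 4 √(log n / n)`. -/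
def epsN (n : ℕ) : ℝ := 4 * √(Real.log n / n)

/-- The quantities carried from one pass of the error monitoring to the next: bounds on the errors
of `g_m`, `u_m`, `d_m` and `‖u_m‖²`. -/
structure ErrState where
  δg : ℝ
  δu : ℝ
  δd : ℝ
  ε4 : ℝ

namespace ErrState

variable (S : H → H) (ε : ℝ) (s : CGState H) (e : ErrState)

/-- `ε_{m,1}`, monitoring the error of `S d_m`. -/
def ε1 : ℝ := xi' ‖s.d‖ 1 e.δd ε

/-- `ε_{m,2}`, monitoring the error of `⟨d_m, S d_m⟩`. -/
def ε2 : ℝ := xi ‖s.d‖ ‖s.d‖ e.δd (e.ε1 ε s)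

/-- `ε_{m,3}`, monitoring the error of `⟨d_m, S d_m⟩⁻¹`. -/
def ε3 : ℝ := zeta (inner ℝ s.d (S s.d)) (e.ε2 ε s)

/-- Monitors the error of `α_m`. -/
def δα : ℝ := xi (‖s.u‖ ^ 2) (inner ℝ s.d (S s.d))⁻¹ e.ε4 (e.ε3 S ε s)

/-- Monitors the error of `g_{m+1}`. -/
def nextδg : ℝ := e.δg + xi (s.α S) ‖s.d‖ (e.δα S ε s) e.δd

/-- Monitors the error of `u_{m+1}`. -/
def nextδu : ℝ := e.δu + xi (s.α S) ‖s.d‖ (e.δα S ε s) (e.ε1 ε s)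

/-- `ε_{m,5}`, monitoring the error of `‖u_m‖⁻²`. -/
def ε5 : ℝ := zeta (‖s.u‖ ^ 2) e.ε4

/-- `ε_{m+1,4}`, monitoring the error of `‖u_{m+1}‖²`. -/
def nextε4 : ℝ := xi ‖s.nextU S‖ ‖s.nextU S‖ (e.nextδu S ε s) (e.nextδu S ε s)

/-- Monitors the error of `β_m`. -/
def δβ : ℝ := xi (‖s.nextU S‖ ^ 2) (‖s.u‖ ^ 2)⁻¹ (e.nextε4 S ε s) (e.ε5 s)

/-- Monitors the error of `d_{m+1} = u_{m+1} + β_m d_m`. -/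
def nextδd : ℝ := e.nextδu S ε s + xi (s.β S) ‖s.d‖ (e.δβ S ε s) e.δd

/-- One pass of the error monitoring. -/
def next : ErrState where
  δg := e.nextδg S ε s
  δu := e.nextδu S ε s
  δd := e.nextδd S ε s
  ε4 := e.nextε4 S ε s

/-- The pass exits: `ε_{m,3}` or `ε_{m,5}` is not defined. -/
def Exits : Prop :=
  ¬ ZetaDefined (inner ℝ s.d (S s.d)) (e.ε2 ε s) ∨ ¬ ZetaDefined (‖s.u‖ ^ 2) e.ε4

end ErrState

/-- The error monitoring sequence along the conjugate gradient iteration. The values that follow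
an exit are meaningless and never used. -/
def errorControl (S : H → H) (b : H) (ε : ℝ) : ℕ → ErrState
  | 0 => ⟨0, ε, ε, xi ‖b‖ ‖b‖ ε ε⟩
  | m + 1 => (errorControl S b ε m).next S ε (cg S b m)

/-- Pass `m`, which produces the quantities of step `m + 1`, either exits or yields
`δ^g_{m+1} > n^{-γ}`. -/
def StopsAt (S : H → H) (b : H) (n : ℕ) (γ : ℝ) (m : ℕ) : Prop :=
  (errorControl S b (epsN n) m).Exits S (epsN n) (cg S b m) ∨
    (n : ℝ) ^ (-γ) < (errorControl S b (epsN n) (m + 1)).δg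

/-- The selected step: the least `m` such that the rule stops at step `m + 1`. -/
def stoppingStep (S : H → H) (b : H) (n : ℕ) (γ : ℝ) : ℕ :=
  sInf {m | StopsAt S b n γ m}

end CG

/-- The kernel PLS estimator, with the error monitoring stopping rule with exponent `γ`, from the
sample `(x i, y i)`, `i < n`. -/
def estimator {𝒳 : Type*} (H : Type*) [NormedAddCommGroup H] [InnerProductSpace ℝ H]
    [CompleteSpace H] [RKHS ℝ H 𝒳 ℝ] (γ : ℝ) {n : ℕ} (x : Fin n → 𝒳) (y : Fin n → ℝ) : H :=
  (cg (empCov x) (empAdjoint x y) (stoppingStep (empCov x) (empAdjoint x y : H) n γ)).g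

end KPLS

end

/-! Let `T` be the inclusion of `H` into L²(P_X) and `f` the class of the regression function. The
empirical iteration is a perturbation of the population conjugate gradient iteration for `T* T g =
T* f`, and three facts combine.

Concentration: a Pinelis inequality for Hilbert space valued sums, with Borel–Cantelli, shows that
almost surely, for all large `n`, both the right-hand side and the operator deviate by at most `epsN
n` (`ae_eventually_norm_empAdjoint_sub_le`, `ae_eventually_norm_empCov_sub_le`).

Monitoring: on that event the computed bounds dominate the true errors (`tracks_cg`), so at the
stopping step the empirical iterate is within `n^{-γ}` of the population iterate with the same
index. For a fixed index before the population residual vanishes, the bounds are O(`epsN`) =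
o(`n^{-γ}`), because `γ < 1/2`; hence the rule does not stop there once `n` is large
(`eventually_not_stopsAt`).

Population convergence: `T` has dense range by universality, so the population iterates converge to
`f` in L² (`tendsto_apply_cg`). If the population residual never vanishes, the stopping step tends
to infinity and convergence follows. If it first vanishes at step `m`, then `T g_m = f`, and the
stopping step equals `m` for large `n`, since the empirical squared residual is then no larger than
its error bound. `tendsto_cg_stoppingStep` joins these cases. -/

namespace KPLS

/-! ### Concentration of sums of independent Hilbert space valued variables. -/

section Pinelis

variable {E : Type*} [NormedAddCommGroup E] [InnerProductSpace ℝ E]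

/-- The power series of cosh in the variable `r ^ 2` has nonnegative coefficients, so cosh is a
convex function of `r ^ 2`. -/
theorem cosh_le_of_sq_eq {r p q w : ℝ} (hw₀ : 0 ≤ w) (hw₁ : w ≤ 1)
    (h : r ^ 2 = w * p ^ 2 + (1 - w) * q ^ 2) :
    Real.cosh r ≤ w * Real.cosh p + (1 - w) * Real.cosh q := by
  refine hasSum_le (fun n => ?_) (Real.hasSum_cosh r)
    (((Real.hasSum_cosh p).mul_left w).add ((Real.hasSum_cosh q).mul_left (1 - w)))
  have hc := (convexOn_pow (𝕜 := ℝ) n).2 (x := p ^ 2) (y := q ^ 2) (sq_nonneg p) (sq_nonneg q)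
    hw₀ (sub_nonneg.2 hw₁) (by ring)
  simp only [smul_eq_mul, ← h, ← pow_mul] at hc
  calc r ^ (2 * n) / ((2 * n).factorial : ℝ)
      ≤ (w * p ^ (2 * n) + (1 - w) * q ^ (2 * n)) / ((2 * n).factorial : ℝ) := by gcongr
    _ = _ := by ring

/-- With `c` the cosine of the angle between `x` and `y`, `‖x + y‖ ^ 2` is the convex combination of
`(‖x‖ + ‖y‖) ^ 2` and `(‖x‖ - ‖y‖) ^ 2` with first weight `(1 + c) / 2`. The inner product is kept
as a separate linear term so that it integrates to zero for a centred `y`. -/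
theorem cosh_norm_add_le (x y : E) :
    Real.cosh ‖x + y‖ ≤ Real.cosh ‖x‖ * (Real.exp ‖y‖ - ‖y‖)
      + Real.sinh ‖x‖ / ‖x‖ * inner ℝ x y := by
  have hsinh : ‖y‖ ≤ Real.sinh ‖y‖ := Real.self_le_sinh_iff.2 (norm_nonneg y)
  have hexp : Real.exp ‖y‖ = Real.cosh ‖y‖ + Real.sinh ‖y‖ := (Real.cosh_add_sinh _).symm
  rcases eq_or_ne x 0 with rfl | hx
  · simp only [zero_add, norm_zero, Real.cosh_zero, inner_zero_left, mul_zero, add_zero, one_mul]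
    linarith
  rcases eq_or_ne y 0 with rfl | hy
  · simp
  have ha : 0 < ‖x‖ := norm_pos_iff.2 hx
  have hb : 0 < ‖y‖ := norm_pos_iff.2 hy
  set c : ℝ := inner ℝ x y / (‖x‖ * ‖y‖) with hc
  have hcab : inner ℝ x y = c * (‖x‖ * ‖y‖) := by rw [hc]; field_simp
  have hc1 : |c| ≤ 1 := abs_real_inner_div_norm_mul_norm_le_one x y
  obtain ⟨hcl, hcu⟩ := abs_le.1 hc1
  have key := cosh_le_of_sq_eq (r := ‖x + y‖) (p := ‖x‖ + ‖y‖) (q := ‖x‖ - ‖y‖) (w := (1 + c) / 2)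
    (by linarith) (by linarith) (by rw [norm_add_sq_real, hcab]; ring)
  rw [Real.cosh_add, Real.cosh_sub] at key
  have hsa : 0 ≤ Real.sinh ‖x‖ := Real.sinh_nonneg_iff.2 ha.le
  have hsc : Real.sinh ‖x‖ ≤ Real.cosh ‖x‖ := (Real.sinh_lt_cosh _).le
  have h1 : c * Real.sinh ‖x‖ * (Real.sinh ‖y‖ - ‖y‖)
      ≤ Real.cosh ‖x‖ * (Real.sinh ‖y‖ - ‖y‖) := by
    refine mul_le_mul_of_nonneg_right ?_ (by linarith)
    nlinarith
  have h2 : Real.sinh ‖x‖ / ‖x‖ * inner ℝ x y = c * Real.sinh ‖x‖ * ‖y‖ := by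
    rw [hcab]; field_simp
  rw [h2, hexp]
  linarith

theorem exp_sub_self_mono {a b : ℝ} (ha : 0 ≤ a) (hab : a ≤ b) :
    Real.exp a - a ≤ Real.exp b - b := by
  have h1 : Real.exp b = Real.exp a * Real.exp (b - a) := by rw [← Real.exp_add]; ring_nf
  have h2 := Real.add_one_le_exp (b - a)
  have h3 := Real.one_le_exp ha
  nlinarith

/-- The Taylor remainder of order three is at most `2/9 * b ^ 3 ≤ b ^ 2 / 9`, and `1/2 + 1/9 ≤ 5/8`.
-/
theorem exp_sub_self_le {b : ℝ} (hb₀ : 0 ≤ b) (hb : b ≤ 1 / 2) :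
    Real.exp b - b ≤ Real.exp (5 / 8 * b ^ 2) := by
  have h1 := Real.exp_bound' hb₀ (by linarith) (n := 3) (by norm_num)
  norm_num [Finset.sum_range_succ, Nat.factorial] at h1
  have h2 := Real.add_one_le_exp (5 / 8 * b ^ 2)
  nlinarith [mul_nonneg (sq_nonneg b) (sub_nonneg.2 hb)]

variable {𝒵 : Type*} [MeasurableSpace 𝒵]

/-- A Hilbert space valued map whose inner products with fixed vectors and with itself are
measurable. The space need not be separable. -/
structure WeaklyMeasurable (ξ : 𝒵 → E) : Prop where
  inner_left : ∀ h : E, Measurable fun z => inner ℝ h (ξ z)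
  inner_self : Measurable fun p : 𝒵 × 𝒵 => inner ℝ (ξ p.1) (ξ p.2)

namespace WeaklyMeasurable

variable {ξ : 𝒵 → E}

theorem sub_const (hξ : WeaklyMeasurable ξ) (m : E) : WeaklyMeasurable fun z => ξ z - m where
  inner_left h := by
    simp only [inner_sub_right]
    exact (hξ.inner_left h).sub_const _
  inner_self := by
    simp only [inner_sub_right, inner_sub_left, real_inner_comm m (ξ _)]
    exact (hξ.inner_self.sub ((hξ.inner_left m).comp measurable_snd)).sub
      (((hξ.inner_left m).comp measurable_fst).sub_const _)

theorem const_smul (hξ : WeaklyMeasurable ξ) (c : ℝ) : WeaklyMeasurable fun z => c • ξ z where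
  inner_left h := by
    simp only [inner_smul_right]
    exact (hξ.inner_left h).const_mul _
  inner_self := by
    simp only [inner_smul_right, real_inner_smul_left]
    exact (hξ.inner_self.const_mul _).const_mul _

/-- Without separability the sum itself need not be strongly measurable, but its squared norm is a
polynomial in measurable inner products. -/
theorem norm_add_sum (hξ : WeaklyMeasurable ξ) (x : E) (n : ℕ) :
    Measurable fun z : Fin n → 𝒵 => ‖x + ∑ i, ξ (z i)‖ := by
  have h : (fun z : Fin n → 𝒵 => ‖x + ∑ i, ξ (z i)‖) = fun z =>
      √(‖x‖ ^ 2 + 2 * ∑ i, inner ℝ x (ξ (z i)) + ∑ i, ∑ j, inner ℝ (ξ (z i)) (ξ (z j))) := by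
    funext z
    rw [← Real.sqrt_sq (norm_nonneg (x + _)), norm_add_sq_real, inner_sum,
      ← real_inner_self_eq_norm_sq (∑ i, ξ (z i)), sum_inner]
    simp only [inner_sum]
  rw [h]
  refine Measurable.sqrt (Measurable.add (Measurable.add measurable_const
    (Measurable.const_mul ?_ _)) ?_)
  · exact Finset.measurable_sum _ fun i _ => (hξ.inner_left x).comp (measurable_pi_apply i)
  · exact Finset.measurable_sum _ fun i _ => Finset.measurable_sum _ fun j _ =>
      hξ.inner_self.comp (f := fun z : Fin n → 𝒵 => (z i, z j))
        ((measurable_pi_apply i).prodMk (measurable_pi_apply j))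

end WeaklyMeasurable

theorem norm_add_sum_le {F 𝒴 : Type*} [SeminormedAddCommGroup F] {ξ : 𝒴 → F} {B : ℝ}
    (hB : ∀ z, ‖ξ z‖ ≤ B) (x : F) {n : ℕ} (z : Fin n → 𝒴) : ‖x + ∑ i, ξ (z i)‖ ≤ ‖x‖ + n * B := by
  refine (norm_add_le _ _).trans (add_le_add_right ?_ _)
  simpa using norm_sum_le_of_le Finset.univ fun i _ => hB (z i)

theorem integrable_cosh_norm_add_sum {ξ : 𝒵 → E} (hξ : WeaklyMeasurable ξ) {B : ℝ}
    (hB : ∀ z, ‖ξ z‖ ≤ B) (x : E) {n : ℕ} (Q : Measure (Fin n → 𝒵)) [IsFiniteMeasure Q] :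
    Integrable (fun z : Fin n → 𝒵 => Real.cosh ‖x + ∑ i, ξ (z i)‖) Q := by
  refine Integrable.of_bound
    (Real.measurable_cosh.comp (hξ.norm_add_sum x n)).aestronglyMeasurable
    (Real.cosh (‖x‖ + n * B)) (Eventually.of_forall fun z => ?_)
  rw [Real.norm_eq_abs, abs_of_pos (Real.cosh_pos _), Real.cosh_le_cosh, abs_norm]
  exact (norm_add_sum_le hB x z).trans (le_abs_self _)

theorem integral_cosh_norm_add_le (P : Measure 𝒵) [IsProbabilityMeasure P] {ξ : 𝒵 → E}
    (hξ : WeaklyMeasurable ξ) {B : ℝ} (hB : ∀ z, ‖ξ z‖ ≤ B)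
    (hmean : ∀ h : E, ∫ z, inner ℝ h (ξ z) ∂P = 0) (x : E) :
    Integrable (fun z => Real.cosh ‖x + ξ z‖) P ∧
      ∫ z, Real.cosh ‖x + ξ z‖ ∂P ≤ Real.cosh ‖x‖ * (Real.exp B - B) := by
  have hmeas : Measurable fun z => ‖x + ξ z‖ := by
    have := (hξ.norm_add_sum x 1).comp (measurable_pi_lambda (fun z (_ : Fin 1) => z)
      fun _ => measurable_id)
    simpa [Function.comp_def] using this
  have hint : Integrable (fun z => Real.cosh ‖x + ξ z‖) P := by
    refine Integrable.of_bound (Real.measurable_cosh.comp hmeas).aestronglyMeasurable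
      (Real.cosh (‖x‖ + B)) (Eventually.of_forall fun z => ?_)
    rw [Real.norm_eq_abs, abs_of_pos (Real.cosh_pos _), Real.cosh_le_cosh, abs_norm]
    exact ((norm_add_le _ _).trans (by gcongr; exact hB z)).trans (le_abs_self _)
  have hinner : Integrable (fun z => inner ℝ x (ξ z)) P := by
    refine Integrable.of_bound (hξ.inner_left x).aestronglyMeasurable (‖x‖ * B)
      (Eventually.of_forall fun z => (norm_inner_le_norm _ _).trans (by gcongr; exact hB z))
  refine ⟨hint, ?_⟩
  calc ∫ z, Real.cosh ‖x + ξ z‖ ∂P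
      ≤ ∫ z, (Real.cosh ‖x‖ * (Real.exp B - B) + Real.sinh ‖x‖ / ‖x‖ * inner ℝ x (ξ z)) ∂P := by
        refine integral_mono hint ((integrable_const _).add (hinner.const_mul _)) fun z => ?_
        refine (cosh_norm_add_le x (ξ z)).trans ?_
        have := mul_le_mul_of_nonneg_left (exp_sub_self_mono (norm_nonneg (ξ z)) (hB z))
          (Real.cosh_pos ‖x‖).le
        simpa using this
    _ = Real.cosh ‖x‖ * (Real.exp B - B) := by
        rw [integral_add (integrable_const _) (hinner.const_mul _),
          integral_const_mul (Real.sinh ‖x‖ / ‖x‖), hmean]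
        simp

/-- The supermartingale argument: the first summand is split off by Fubini and absorbed into the
starting point, which is why `x` is arbitrary in the induction. -/
theorem integral_cosh_norm_add_sum_le (P : Measure 𝒵) [IsProbabilityMeasure P] {ξ : 𝒵 → E}
    (hξ : WeaklyMeasurable ξ) {B : ℝ} (hB : ∀ z, ‖ξ z‖ ≤ B)
    (hmean : ∀ h : E, ∫ z, inner ℝ h (ξ z) ∂P = 0) (n : ℕ) (x : E) :
    ∫ z : Fin n → 𝒵, Real.cosh ‖x + ∑ i, ξ (z i)‖ ∂(Measure.pi fun _ => P)
      ≤ Real.cosh ‖x‖ * (Real.exp B - B) ^ n := by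
  have hC : 0 ≤ Real.exp B - B := by linarith [Real.add_one_le_exp B]
  induction n generalizing x with
  | zero => simp
  | succ n ih =>
    have hmp := (measurePreserving_piFinSuccAbove (fun _ : Fin (n + 1) => P) 0).symm
    have hme := (MeasurableEquiv.piFinSuccAbove (fun _ : Fin (n + 1) => 𝒵) 0).symm.measurableEmbedding
    rw [← hmp.integral_comp hme, integral_prod]
    · have hsum : ∀ (z₀ : 𝒵) (z : Fin n → 𝒵), x + ∑ i, ξ
          ((MeasurableEquiv.piFinSuccAbove (fun _ : Fin (n + 1) => 𝒵) 0).symm (z₀, z) i)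
          = (x + ξ z₀) + ∑ i, ξ (z i) := by
        intro z₀ z
        rw [Fin.sum_univ_succ, add_assoc]
        simp [MeasurableEquiv.piFinSuccAbove]
      simp only [hsum]
      obtain ⟨hint, hle⟩ := integral_cosh_norm_add_le P hξ hB hmean x
      calc _ ≤ ∫ z₀, Real.cosh ‖x + ξ z₀‖ * (Real.exp B - B) ^ n ∂P := by
            -- This form of monotonicity does not ask for integrability of the inner integral in
            -- `z₀`.
            refine integral_mono_of_nonneg (Eventually.of_forall fun z₀ => ?_)
              (hint.mul_const _) (Eventually.of_forall fun z₀ => ih (x + ξ z₀))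
            exact integral_nonneg fun z => (Real.cosh_pos _).le
        _ = (∫ z₀, Real.cosh ‖x + ξ z₀‖ ∂P) * (Real.exp B - B) ^ n := integral_mul_const _ _
        _ ≤ Real.cosh ‖x‖ * (Real.exp B - B) * (Real.exp B - B) ^ n := by gcongr
        _ = _ := by ring
    · exact (hmp.integrable_comp_emb hme).2 (integrable_cosh_norm_add_sum hξ hB x _)

/-- Markov's inequality for cosh after scaling by `l = √(log n / n)`: the threshold becomes `4 log
n`, the expectation is at most `exp (5/2 * log n)`, and the quotient gives the summable power
`-3/2`. -/
theorem measure_norm_sum_ge_le (P : Measure 𝒵) [IsProbabilityMeasure P] {ξ : 𝒵 → E}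
    (hξ : WeaklyMeasurable ξ) (hB : ∀ z, ‖ξ z‖ ≤ 2)
    (hmean : ∀ h : E, ∫ z, inner ℝ h (ξ z) ∂P = 0) {n : ℕ} (hn : 1 ≤ n)
    (hlog : 16 * Real.log n ≤ n) :
    (Measure.pi fun _ : Fin n => P).real {z | n * epsN n ≤ ‖∑ i, ξ (z i)‖}
      ≤ 2 * (n : ℝ) ^ (-(3 / 2) : ℝ) := by
  have hn0 : (0 : ℝ) < n := by exact_mod_cast hn
  have hlog0 : 0 ≤ Real.log n := Real.log_natCast_nonneg n
  set l : ℝ := √(Real.log n / n) with hl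
  have hl0 : 0 ≤ l := Real.sqrt_nonneg _
  have hl2 : n * l ^ 2 = Real.log n := by
    rw [hl, Real.sq_sqrt (by positivity)]; field_simp
  -- Ensures `2 * l ≤ 1 / 2`, as `exp_sub_self_le` requires.
  have hl4 : l ≤ 1 / 4 := by
    refine Real.sqrt_le_iff.2 ⟨by norm_num, ?_⟩
    rw [div_le_iff₀ hn0]; linarith
  have hξl := hξ.const_smul l
  have hBl : ∀ z, ‖l • ξ z‖ ≤ 2 * l := fun z => by
    rw [norm_smul, Real.norm_of_nonneg hl0]; nlinarith [hB z]
  have hmeanl : ∀ h : E, ∫ z, inner ℝ h (l • ξ z) ∂P = 0 := fun h => by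
    simp only [inner_smul_right, integral_const_mul, hmean, mul_zero]
  have hI := integral_cosh_norm_add_sum_le P hξl hBl hmeanl n 0
  have hcosh : Real.cosh ‖(0 : E)‖ = 1 := by simp
  have hexp : (Real.exp (2 * l) - 2 * l) ^ n ≤ Real.exp (5 / 2 * Real.log n) := by
    calc (Real.exp (2 * l) - 2 * l) ^ n ≤ Real.exp (5 / 8 * (2 * l) ^ 2) ^ n := by
          refine pow_le_pow_left₀ ?_ (exp_sub_self_le (by positivity) (by linarith)) n
          linarith [Real.add_one_le_exp (2 * l)]
      _ = Real.exp (5 / 2 * Real.log n) := by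
          rw [← Real.exp_nat_mul, ← hl2]; ring_nf
  rw [hcosh, one_mul] at hI
  have hmark := mul_meas_ge_le_integral_of_nonneg
    (Eventually.of_forall fun z => (Real.cosh_pos _).le)
    (integrable_cosh_norm_add_sum hξl hBl 0 (Measure.pi fun _ : Fin n => P))
    (Real.exp (4 * Real.log n) / 2)
  have hsub : {z : Fin n → 𝒵 | n * epsN n ≤ ‖∑ i, ξ (z i)‖} ⊆
      {z | Real.exp (4 * Real.log n) / 2 ≤ Real.cosh ‖0 + ∑ i, l • ξ (z i)‖} := by
    intro z hz
    simp only [Set.mem_ofPred_eq] at hz ⊢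
    rw [zero_add, ← Finset.smul_sum, norm_smul, Real.norm_of_nonneg hl0, Real.cosh_eq]
    have h4 : 4 * Real.log n ≤ l * ‖∑ i, ξ (z i)‖ := by
      calc 4 * Real.log n = l * (n * epsN n) := by rw [← hl2, epsN, ← hl]; ring
        _ ≤ _ := by gcongr
    have := Real.exp_le_exp.2 h4
    have := Real.exp_pos (-(l * ‖∑ i, ξ (z i)‖))
    linarith
  have hmono := measureReal_mono (μ := Measure.pi fun _ : Fin n => P) hsub
  set p := (Measure.pi fun _ : Fin n => P).real
    {z | Real.exp (4 * Real.log n) / 2 ≤ Real.cosh ‖0 + ∑ i, l • ξ (z i)‖}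
  refine hmono.trans ?_
  have hle : Real.exp (4 * Real.log n) / 2 * p ≤ Real.exp (5 / 2 * Real.log n) :=
    hmark.trans (hI.trans hexp)
  have hsplit : Real.exp (5 / 2 * Real.log n)
      = Real.exp (4 * Real.log n) * (n : ℝ) ^ (-(3 / 2) : ℝ) := by
    rw [Real.rpow_def_of_pos hn0, ← Real.exp_add]; ring_nf
  rw [hsplit] at hle
  have he := Real.exp_pos (4 * Real.log n)
  refine le_of_mul_le_mul_left ?_ he
  linarith

/-- Riesz representation of `h ↦ E⟨h, Z⟩`; this weak mean replaces the Bochner integral, which would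
need strong measurability. -/
theorem exists_weak_mean [CompleteSpace E] (P : Measure 𝒵) [IsProbabilityMeasure P] {Z : 𝒵 → E}
    (hZ : WeaklyMeasurable Z) (hb : ∀ z, ‖Z z‖ ≤ 1) :
    ∃ m : E, ‖m‖ ≤ 1 ∧ ∀ h : E, inner ℝ h m = ∫ z, inner ℝ h (Z z) ∂P := by
  have hint : ∀ h, Integrable (fun z => inner ℝ h (Z z)) P := fun h =>
    Integrable.of_bound (hZ.inner_left h).aestronglyMeasurable (‖h‖ * 1)
      (Eventually.of_forall fun z => (norm_inner_le_norm _ _).trans (by gcongr; exact hb z))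
  let L : E →ₗ[ℝ] ℝ :=
    { toFun := fun h => ∫ z, inner ℝ h (Z z) ∂P
      map_add' := fun h h' => by
        simp only [inner_add_left]
        exact integral_add (hint h) (hint h')
      map_smul' := fun c h => by
        simp only [real_inner_smul_left, integral_const_mul, RingHom.id_apply, smul_eq_mul] }
  have hL : ∀ h, ‖L h‖ ≤ 1 * ‖h‖ := fun h => by
    have := norm_integral_le_of_norm_le_const (μ := P) (f := fun z => inner ℝ h (Z z)) (C := ‖h‖)
      (Eventually.of_forall fun z => (norm_inner_le_norm _ _).trans
        (mul_le_of_le_one_right (norm_nonneg _) (hb z)))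
    rw [probReal_univ, mul_one] at this
    rw [one_mul]
    exact this
  refine ⟨(InnerProductSpace.toDual ℝ E).symm (L.mkContinuous 1 hL), ?_, fun h => ?_⟩
  · rw [LinearIsometryEquiv.norm_map]
    exact L.mkContinuous_norm_le zero_le_one hL
  · rw [real_inner_comm, InnerProductSpace.toDual_symm_apply]
    rfl

theorem eventually_sixteen_mul_log_le : ∀ᶠ n : ℕ in atTop, 16 * Real.log n ≤ n := by
  have h := (Real.isLittleO_log_id_atTop.comp_tendsto tendsto_natCast_atTop_atTop).bound
    (show (0 : ℝ) < 1 / 16 by norm_num)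
  filter_upwards [h] with n hn
  simp only [Function.comp_apply, id, Real.norm_eq_abs, Nat.abs_cast] at hn
  linarith [le_abs_self (Real.log n)]

theorem ae_eventually_norm_sum_lt {Ω : Type*} [MeasurableSpace Ω] (μ : Measure Ω)
    [IsProbabilityMeasure μ] (P : Measure 𝒵) [IsProbabilityMeasure P] {W : ℕ → Ω → 𝒵}
    (hW : ∀ i, Measurable (W i)) (hlaw : ∀ i, μ.map (W i) = P) (hindep : iIndepFun W μ)
    {ξ : 𝒵 → E} (hξ : WeaklyMeasurable ξ) (hB : ∀ z, ‖ξ z‖ ≤ 2)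
    (hmean : ∀ h : E, ∫ z, inner ℝ h (ξ z) ∂P = 0) :
    ∀ᵐ ω ∂μ, ∀ᶠ n : ℕ in atTop, ‖∑ i : Fin n, ξ (W i ω)‖ < n * epsN n := by
  obtain ⟨N, hN⟩ := eventually_atTop.1 eventually_sixteen_mul_log_le
  -- The shift by `N + 1` makes the tail bound valid for every index, so that Borel–Cantelli applies
  -- to the whole sequence.
  let A : ℕ → Set Ω := fun n => {ω | (n + (N + 1) : ℕ) * epsN (n + (N + 1))
    ≤ ‖∑ i : Fin (n + (N + 1)), ξ (W i ω)‖}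
  have hA : ∀ n, μ (A n) ≤ ENNReal.ofReal (2 * ((n + (N + 1) : ℕ) : ℝ) ^ (-(3 / 2) : ℝ)) := by
    intro n
    have hi : iIndepFun (fun i : Fin (n + (N + 1)) => W i) μ := hindep.precomp Fin.val_injective
    have hmap := (iIndepFun_iff_map_fun_eq_pi_map fun i => (hW _).aemeasurable).1 hi
    simp only [hlaw] at hmap
    have hz : MeasurableSet {z : Fin (n + (N + 1)) → 𝒵 | (n + (N + 1) : ℕ) * epsN (n + (N + 1))
        ≤ ‖∑ i, ξ (z i)‖} := by
      refine measurableSet_le measurable_const ?_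
      simpa using hξ.norm_add_sum 0 (n + (N + 1))
    have h := measure_norm_sum_ge_le P hξ hB hmean (n := n + (N + 1)) (by omega)
      (hN _ (by omega))
    rw [← hmap, map_measureReal_apply (measurable_pi_lambda _ fun i => hW _) hz] at h
    rw [← ofReal_measureReal (measure_ne_top _ _)]
    exact ENNReal.ofReal_le_ofReal h
  have hsum : Summable fun n : ℕ => 2 * ((n + (N + 1) : ℕ) : ℝ) ^ (-(3 / 2) : ℝ) :=
    ((summable_nat_add_iff (N + 1)).2
      (Real.summable_nat_rpow.2 (by norm_num : (-(3 / 2) : ℝ) < -1))).mul_left 2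
  have hfin : ∑' n, μ (A n) ≠ ⊤ :=
    ne_top_of_le_ne_top hsum.tsum_ofReal_ne_top (ENNReal.tsum_le_tsum hA)
  filter_upwards [ae_eventually_notMem hfin] with ω hω
  obtain ⟨M, hM⟩ := eventually_atTop.1 hω
  refine eventually_atTop.2 ⟨M + (N + 1), fun n hn => ?_⟩
  obtain ⟨k, rfl⟩ : ∃ k, n = k + (N + 1) := ⟨n - (N + 1), by omega⟩
  exact not_le.1 (hM k (by omega))

theorem ae_eventually_norm_mean_sub_le [CompleteSpace E] {Ω : Type*} [MeasurableSpace Ω]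
    (μ : Measure Ω) [IsProbabilityMeasure μ] (P : Measure 𝒵) [IsProbabilityMeasure P]
    {W : ℕ → Ω → 𝒵} (hW : ∀ i, Measurable (W i)) (hlaw : ∀ i, μ.map (W i) = P)
    (hindep : iIndepFun W μ) {Z : 𝒵 → E} (hZ : WeaklyMeasurable Z) (hb : ∀ z, ‖Z z‖ ≤ 1) :
    ∃ m : E, (∀ h : E, inner ℝ h m = ∫ z, inner ℝ h (Z z) ∂P) ∧
      ∀ᵐ ω ∂μ, ∀ᶠ n : ℕ in atTop, ‖(n : ℝ)⁻¹ • ∑ i : Fin n, Z (W i ω) - m‖ ≤ epsN n := by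
  obtain ⟨m, hm1, hm⟩ := exists_weak_mean P hZ hb
  refine ⟨m, hm, ?_⟩
  have hmean : ∀ h : E, ∫ z, inner ℝ h (Z z - m) ∂P = 0 := fun h => by
    have hint : Integrable (fun z => inner ℝ h (Z z)) P :=
      Integrable.of_bound (hZ.inner_left h).aestronglyMeasurable (‖h‖ * 1)
        (Eventually.of_forall fun z => (norm_inner_le_norm _ _).trans (by gcongr; exact hb z))
    simp only [inner_sub_right]
    rw [integral_sub hint (integrable_const _), hm]
    simp
  have hB : ∀ z, ‖Z z - m‖ ≤ 2 := fun z =>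
    (norm_sub_le _ _).trans (by linarith [hb z])
  filter_upwards [ae_eventually_norm_sum_lt μ P hW hlaw hindep (hZ.sub_const m) hB hmean]
    with ω hω
  filter_upwards [hω, eventually_gt_atTop 0] with n hn hn0
  have hn0' : (0 : ℝ) < n := by exact_mod_cast hn0
  have heq : (n : ℝ)⁻¹ • ∑ i : Fin n, Z (W i ω) - m
      = (n : ℝ)⁻¹ • ∑ i : Fin n, (Z (W i ω) - m) := by
    rw [Finset.sum_sub_distrib, smul_sub]
    simp [← Nat.cast_smul_eq_nsmul ℝ, smul_smul, hn0'.ne']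
  rw [heq, norm_smul, norm_inv, Real.norm_of_nonneg hn0'.le, inv_mul_le_iff₀ hn0']
  exact hn.le

end Pinelis

/-! ### Orthogonality, termination and convergence of conjugate gradients. -/

section ConjugateGradients

variable {H : Type*} [NormedAddCommGroup H] [InnerProductSpace ℝ H]

theorem cg_u_succ (S : H → H) (b : H) (m : ℕ) :
    (cg S b (m + 1)).u = (cg S b m).u - (cg S b m).α S • S (cg S b m).d := rfl

theorem cg_d_succ (S : H → H) (b : H) (m : ℕ) :
    (cg S b (m + 1)).d = (cg S b (m + 1)).u + (cg S b m).β S • (cg S b m).d := rfl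

theorem cg_g_succ (S : H → H) (b : H) (m : ℕ) :
    (cg S b (m + 1)).g = (cg S b m).g + (cg S b m).α S • (cg S b m).d := rfl

theorem cg_β (S : H → H) (b : H) (m : ℕ) :
    (cg S b m).β S = ‖(cg S b (m + 1)).u‖ ^ 2 / ‖(cg S b m).u‖ ^ 2 := rfl

theorem cg_u_eq (S : H →ₗ[ℝ] H) (b : H) (m : ℕ) : (cg S b m).u = b - S (cg S b m).g := by
  induction m with
  | zero => simp [cg]
  | succ m ih => rw [cg_u_succ, cg_g_succ, ih, map_add, map_smul]; abel

/-- The iteration has not broken down in its first `m` passes. -/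
def Regular (S : H → H) (b : H) (m : ℕ) : Prop :=
  ∀ j < m, (cg S b j).u ≠ 0 ∧ inner ℝ (cg S b j).d (S (cg S b j).d) ≠ 0

theorem Regular.mono {S : H → H} {b : H} {m n : ℕ} (h : Regular S b n) (hmn : m ≤ n) :
    Regular S b m := fun j hj => h j (hj.trans_le hmn)

theorem Regular.α_ne_zero {S : H → H} {b : H} {m j : ℕ} (h : Regular S b m) (hj : j < m) :
    (cg S b j).α S ≠ 0 :=
  div_ne_zero (pow_ne_zero 2 (norm_ne_zero_iff.2 (h j hj).1)) (h j hj).2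

theorem Regular.apply_d {S : H → H} {b : H} {m j : ℕ} (h : Regular S b m) (hj : j < m) :
    S (cg S b j).d = ((cg S b j).α S)⁻¹ • ((cg S b j).u - (cg S b (j + 1)).u) := by
  rw [cg_u_succ, sub_sub_cancel, smul_smul, inv_mul_cancel₀ (h.α_ne_zero hj), one_smul]

theorem inner_u_d_self_of {S : H → H} {b : H} {m : ℕ}
    (h : ∀ i < m, inner ℝ (cg S b m).u (cg S b i).d = 0) :
    inner ℝ (cg S b m).u (cg S b m).d = ‖(cg S b m).u‖ ^ 2 := by
  cases m with
  | zero => exact real_inner_self_eq_norm_sq _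
  | succ m =>
    rw [cg_d_succ, inner_add_right, real_inner_self_eq_norm_sq, inner_smul_right,
      h m (Nat.lt_succ_self m), mul_zero, add_zero]

theorem inner_u_u_of {S : H → H} {b : H} {m : ℕ}
    (h : ∀ i < m, inner ℝ (cg S b m).u (cg S b i).d = 0) {i : ℕ} (hi : i < m) :
    inner ℝ (cg S b m).u (cg S b i).u = 0 := by
  cases i with
  | zero => exact h 0 hi
  | succ i =>
    have : (cg S b (i + 1)).u = (cg S b (i + 1)).d - (cg S b i).β S • (cg S b i).d := by
      rw [cg_d_succ, add_sub_cancel_right]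
    rw [this, inner_sub_right, inner_smul_right, h _ hi, h i (by omega), mul_zero, sub_zero]

/-- Both relations are proved together. The choice of `α` cancels the newest term of the first and
the choice of `β` that of the second; older terms vanish because `S d_i` is a multiple of `u_i -
u_{i+1}`. -/
theorem Regular.orthogonal {S : H →ₗ[ℝ] H} (hS : S.IsSymmetric) {b : H} {m : ℕ}
    (h : Regular S b m) :
    (∀ i < m, inner ℝ (cg S b m).u (cg S b i).d = 0) ∧
      ∀ i < m, inner ℝ (cg S b m).d (S (cg S b i).d) = 0 := by
  induction m with
  | zero => simp
  | succ m ih =>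
    obtain ⟨ihu, ihd⟩ := ih (h.mono m.le_succ)
    have hA := (h m m.lt_succ_self).2
    have hu0 : ‖(cg S b m).u‖ ^ 2 ≠ 0 :=
      pow_ne_zero 2 (norm_ne_zero_iff.2 (h m m.lt_succ_self).1)
    have hud : ∀ i < m + 1, inner ℝ (cg S b (m + 1)).u (cg S b i).d = 0 := by
      intro i hi
      rw [cg_u_succ, inner_sub_left, real_inner_smul_left, hS]
      rcases Nat.lt_succ_iff_lt_or_eq.1 hi with hi | rfl
      · rw [ihu i hi, ihd i hi, mul_zero, sub_zero]
      · rw [inner_u_d_self_of ihu, CGState.α, div_mul_cancel₀ _ hA, sub_self]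
    refine ⟨hud, fun i hi => ?_⟩
    rw [cg_d_succ, inner_add_left, real_inner_smul_left, h.apply_d hi, inner_smul_right,
      inner_sub_right, inner_u_u_of hud hi]
    rcases Nat.lt_succ_iff_lt_or_eq.1 hi with hi' | rfl
    · rw [inner_u_u_of hud (by omega : i + 1 < m + 1), ← h.apply_d hi, ihd i hi']
      simp
    · rw [← h.apply_d hi, real_inner_self_eq_norm_sq, cg_β, CGState.α]
      field_simp
      ring

theorem Regular.inner_u_u {S : H →ₗ[ℝ] H} (hS : S.IsSymmetric) {b : H} {m : ℕ}
    (h : Regular S b m) {i : ℕ} (hi : i < m) : inner ℝ (cg S b m).u (cg S b i).u = 0 :=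
  inner_u_u_of (h.orthogonal hS).1 hi

/-- In a finite-dimensional space conjugate gradients terminate. -/
theorem exists_not_regular {S : H →ₗ[ℝ] H} (hS : S.IsSymmetric) {b : H} (V : Submodule ℝ H)
    [FiniteDimensional ℝ V] (hSV : ∀ x, S x ∈ V) (hb : b ∈ V) : ∃ m, ¬ Regular S b m := by
  -- Without a breakdown the residuals would be infinitely many nonzero, pairwise orthogonal vectors
  -- of `V`.
  by_contra! hreg
  have hmem : ∀ m, (cg S b m).u ∈ V := fun m => by
    rw [cg_u_eq]; exact V.sub_mem hb (hSV _)
  let v : ℕ → V := fun m => ⟨(cg S b m).u, hmem m⟩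
  have hli : LinearIndependent ℝ v := by
    refine linearIndependent_of_ne_zero_of_inner_eq_zero (𝕜 := ℝ) (fun m hm => ?_)
      (fun i j hij => ?_)
    · exact (hreg (m + 1) m m.lt_succ_self).1 (congrArg Subtype.val hm)
    · change inner ℝ (cg S b i).u (cg S b j).u = 0
      rcases lt_or_gt_of_ne hij with h | h
      · rw [real_inner_comm]; exact (hreg j).inner_u_u hS h
      · exact (hreg i).inner_u_u hS h
  exact Infinite.not_finite (α := ℕ) hli.finite

/-- The span of the first `m` search directions. -/
def searchSpace (S : H → H) (b : H) (m : ℕ) : Submodule ℝ H :=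
  Submodule.span ℝ ((fun i => (cg S b i).d) '' Set.Iio m)

theorem d_mem_searchSpace (S : H → H) (b : H) {i m : ℕ} (h : i < m) :
    (cg S b i).d ∈ searchSpace S b m := Submodule.subset_span ⟨i, h, rfl⟩

theorem searchSpace_mono (S : H → H) (b : H) : Monotone (searchSpace S b) := fun _ _ h =>
  Submodule.span_mono (Set.image_mono (Set.Iio_subset_Iio h))

theorem g_mem_searchSpace (S : H → H) (b : H) (m : ℕ) : (cg S b m).g ∈ searchSpace S b m := by
  induction m with
  | zero => exact Submodule.zero_mem _
  | succ m ih =>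
    rw [cg_g_succ]
    exact Submodule.add_mem _ (searchSpace_mono S b m.le_succ ih)
      (Submodule.smul_mem _ _ (d_mem_searchSpace S b m.lt_succ_self))

theorem u_mem_searchSpace (S : H → H) (b : H) (m : ℕ) :
    (cg S b m).u ∈ searchSpace S b (m + 1) := by
  cases m with
  | zero => exact d_mem_searchSpace S b Nat.zero_lt_one
  | succ m =>
    have : (cg S b (m + 1)).u = (cg S b (m + 1)).d - (cg S b m).β S • (cg S b m).d := by
      rw [cg_d_succ, add_sub_cancel_right]
    rw [this]
    exact Submodule.sub_mem _ (d_mem_searchSpace S b (by omega))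
      (Submodule.smul_mem _ _ (d_mem_searchSpace S b (by omega)))

variable {G : Type*} [NormedAddCommGroup G] [InnerProductSpace ℝ G] [CompleteSpace G]
  [CompleteSpace H]

/-- The normal operator `T* T`. -/
noncomputable def normalOp (T : H →L[ℝ] G) : H →ₗ[ℝ] H := (T.adjoint ∘L T : H →L[ℝ] H)

variable (T : H →L[ℝ] G) (f : G)

theorem normalOp_apply (x : H) : normalOp T x = T.adjoint (T x) := rfl

theorem inner_normalOp (x y : H) : inner ℝ x (normalOp T y) = inner ℝ (T x) (T y) := by
  rw [normalOp_apply, ContinuousLinearMap.adjoint_inner_right]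

theorem normalOp_isSymmetric : (normalOp T).IsSymmetric := fun x y => by
  rw [inner_normalOp, real_inner_comm, inner_normalOp, real_inner_comm]

theorem inner_normalOp_self (x : H) : inner ℝ x (normalOp T x) = ‖T x‖ ^ 2 := by
  rw [inner_normalOp, real_inner_self_eq_norm_sq]

theorem cg_normal_u (m : ℕ) :
    (cg (normalOp T) (T.adjoint f) m).u
      = T.adjoint (f - T (cg (normalOp T) (T.adjoint f) m).g) := by
  rw [cg_u_eq, map_sub, normalOp_apply]

theorem inner_cg_normal_u (m : ℕ) (x : H) :
    inner ℝ (cg (normalOp T) (T.adjoint f) m).u x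
      = inner ℝ (f - T (cg (normalOp T) (T.adjoint f) m).g) (T x) := by
  rw [cg_normal_u, ContinuousLinearMap.adjoint_inner_left]

/-- For normal equations only a vanishing residual causes breakdown: if `T d = 0`, then `‖u‖ ^ 2 =
⟨u, d⟩ = ⟨f - T g, T d⟩ = 0`. -/
theorem regular_normal {m : ℕ} (h : ∀ j < m, (cg (normalOp T) (T.adjoint f) j).u ≠ 0) :
    Regular (normalOp T) (T.adjoint f) m := by
  induction m with
  | zero => intro j hj; omega
  | succ m ih =>
    have hreg := ih fun j hj => h j (by omega)
    intro j hj
    rcases Nat.lt_succ_iff_lt_or_eq.1 hj with hj | rfl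
    · exact hreg j hj
    refine ⟨h j hj, fun h0 => ?_⟩
    rw [inner_normalOp_self, sq_eq_zero_iff, norm_eq_zero] at h0
    have h1 := inner_u_d_self_of (hreg.orthogonal (normalOp_isSymmetric T)).1
    rw [inner_cg_normal_u, h0, inner_zero_right] at h1
    exact h j hj (norm_eq_zero.1 (sq_eq_zero_iff.1 h1.symm))

theorem inner_self_normal_pos {m : ℕ}
    (h : ∀ j ≤ m, (cg (normalOp T) (T.adjoint f) j).u ≠ 0) :
    0 < inner ℝ (cg (normalOp T) (T.adjoint f) m).d
      (normalOp T (cg (normalOp T) (T.adjoint f) m).d) := by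
  have := (regular_normal T f (m := m + 1) (fun j hj => h j (by omega)) m m.lt_succ_self).2
  refine lt_of_le_of_ne ?_ this.symm
  rw [inner_normalOp_self]
  positivity

theorem eq_zero_of_adjoint_eq_zero {T : H →L[ℝ] G} (hT : DenseRange T) {h : G}
    (h0 : T.adjoint h = 0) : h = 0 := by
  refine hT.eq_zero_of_inner_left ℝ fun x => ?_
  rw [← ContinuousLinearMap.adjoint_inner_left, h0, inner_zero_left]

theorem apply_cg_eq_of_u_eq_zero {T : H →L[ℝ] G} (hT : DenseRange T) {f : G} {m : ℕ}
    (h : (cg (normalOp T) (T.adjoint f) m).u = 0) :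
    T (cg (normalOp T) (T.adjoint f) m).g = f := by
  rw [cg_normal_u] at h
  exact (sub_eq_zero.1 (eq_zero_of_adjoint_eq_zero hT h)).symm

/-- Since `⟨f - T g, T v⟩ = ⟨u, v⟩`, orthogonality of the residual to earlier directions makes `T g`
the orthogonal projection of `f` on the image of the search space; Pythagoras concludes. -/
theorem norm_sub_apply_cg_le {m : ℕ} (h : Regular (normalOp T) (T.adjoint f) m) {w : H}
    (hw : w ∈ searchSpace (normalOp T) (T.adjoint f) m) :
    ‖f - T (cg (normalOp T) (T.adjoint f) m).g‖ ≤ ‖f - T w‖ := by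
  set g := (cg (normalOp T) (T.adjoint f) m).g
  have horth : ∀ v ∈ searchSpace (normalOp T) (T.adjoint f) m,
      inner ℝ (f - T g) (T v) = 0 := by
    intro v hv
    rw [← inner_cg_normal_u]
    induction hv using Submodule.span_induction with
    | mem v hv =>
      obtain ⟨i, hi, rfl⟩ := hv
      exact (h.orthogonal (normalOp_isSymmetric T)).1 i hi
    | zero => exact inner_zero_right _
    | add v v' _ _ hv hv' => rw [inner_add_right, hv, hv', add_zero]
    | smul c v _ hv => rw [inner_smul_right, hv, mul_zero]
  have h0 := horth _ (Submodule.sub_mem _ (g_mem_searchSpace _ _ m) hw)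
  have heq : f - T w = (f - T g) + T (g - w) := by rw [map_sub]; abel
  have hsq : ‖f - T w‖ ^ 2 = ‖f - T g‖ ^ 2 + ‖T (g - w)‖ ^ 2 := by
    rw [heq, norm_add_sq_real, h0]; ring
  refine le_of_sq_le_sq ?_ (norm_nonneg _)
  rw [hsq]
  exact le_add_of_nonneg_right (sq_nonneg _)

/-- Let `p` be the projection of `f` on the closure `K`. Invariance puts `T T* (f - p)` in `K`, so
`‖T* (f - p)‖ ^ 2 = ⟨f - p, T T* (f - p)⟩ = 0`, and `T*` is injective because `T` has dense range.
-/
theorem mem_closure_map_of_invariant {T : H →L[ℝ] G} (hT : DenseRange T) (f : G)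
    {D : Submodule ℝ H} (hD : ∀ x ∈ D, normalOp T x ∈ D) (hb : T.adjoint f ∈ D) :
    f ∈ (D.map (T : H →ₗ[ℝ] G)).topologicalClosure := by
  set K := (D.map (T : H →ₗ[ℝ] G)).topologicalClosure with hK
  have hKc : IsClosed (K : Set G) := Submodule.isClosed_topologicalClosure _
  have : CompleteSpace K := hKc.completeSpace_coe
  have hmem : ∀ x ∈ D, T x ∈ K := fun x hx =>
    Submodule.le_topologicalClosure _ (Submodule.mem_map_of_mem hx)
  have hinv : ∀ p ∈ K, T (T.adjoint p) ∈ K := by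
    intro p hp
    refine closure_minimal (t := (fun p => T (T.adjoint p)) ⁻¹' (K : Set G)) ?_
      (hKc.preimage (T.continuous.comp T.adjoint.continuous)) hp
    rintro _ ⟨x, hx, rfl⟩
    exact hmem _ (hD x hx)
  set p : G := K.starProjection f with hp
  have hpK : p ∈ K := Submodule.starProjection_apply_mem K f
  have horth : ∀ w ∈ K, inner ℝ (f - p) w = 0 := fun w hw =>
    Submodule.starProjection_inner_eq_zero f w hw
  have h1 : inner ℝ (f - p) (T (T.adjoint (f - p))) = 0 := by
    rw [map_sub, map_sub, inner_sub_right, horth _ (hmem _ hb), horth _ (hinv p hpK), sub_zero]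
  rw [← ContinuousLinearMap.adjoint_inner_left, inner_self_eq_zero] at h1
  rw [sub_eq_zero.1 (eq_zero_of_adjoint_eq_zero hT h1)]
  exact hpK

/-- The union of the search spaces contains `T* f` and is invariant, as `S d_i` is a combination of
`u_i` and `u_{i+1}`. Its image is therefore dense enough to approximate `f`, and best approximation
transfers this to the iterates. -/
theorem tendsto_apply_cg {T : H →L[ℝ] G} (hT : DenseRange T) {f : G}
    (h : ∀ m, (cg (normalOp T) (T.adjoint f) m).u ≠ 0) :
    Tendsto (fun m => T (cg (normalOp T) (T.adjoint f) m).g) atTop (𝓝 f) := by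
  set S := normalOp T
  set b := T.adjoint f
  have hreg : ∀ m, Regular S b m := fun m => regular_normal T f fun j _ => h j
  set D : Submodule ℝ H := ⨆ m, searchSpace S b m
  have hdir : Directed (· ≤ ·) (searchSpace S b) := (searchSpace_mono S b).directed_le
  have hle : ∀ m, searchSpace S b m ≤ D := le_iSup _
  have hinv : ∀ x ∈ D, S x ∈ D := by
    intro x hx
    obtain ⟨m, hm⟩ := (Submodule.mem_iSup_of_directed _ hdir).1 hx
    induction hm using Submodule.span_induction with
    | mem v hv =>
      obtain ⟨i, _, rfl⟩ := hv
      dsimp only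
      rw [(hreg (i + 1)).apply_d i.lt_succ_self]
      exact Submodule.smul_mem _ _ (Submodule.sub_mem _ (hle _ (u_mem_searchSpace _ _ i))
        (hle _ (u_mem_searchSpace _ _ (i + 1))))
    | zero => simp
    | add v v' hv hv' ih ih' =>
      rw [map_add]; exact Submodule.add_mem _ (ih (hle _ hv)) (ih' (hle _ hv'))
    | smul c v hv ih => rw [map_smul]; exact Submodule.smul_mem _ _ (ih (hle _ hv))
  have hf := mem_closure_map_of_invariant hT f hinv (hle 1 (d_mem_searchSpace S b one_pos))
  rw [Metric.tendsto_atTop]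
  intro ε hε
  obtain ⟨_, ⟨w, hw, rfl⟩, hwε⟩ := Metric.mem_closure_iff.1 hf ε hε
  obtain ⟨M, hM⟩ := (Submodule.mem_iSup_of_directed _ hdir).1 hw
  refine ⟨M, fun m hm => ?_⟩
  rw [dist_comm, dist_eq_norm]
  rw [dist_eq_norm] at hwε
  exact (norm_sub_apply_cg_le T f (hreg m) (searchSpace_mono S b hm hM)).trans_lt hwε

end ConjugateGradients

/-! ### Validity and size of the monitored error bounds, and the stopping rule. -/

section ErrorControl

variable {H : Type*} [NormedAddCommGroup H] [InnerProductSpace ℝ H]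

/-- The product difference is expanded around the unprimed, computed quantities, so that the bound
can be evaluated from the data. Upper bounds `X`, `Y` in place of exact norms allow `‖S d‖` to be
replaced by `‖d‖`. -/
theorem norm_smul_sub_smul_le {c c' δc X Y δv : ℝ} {v v' : H} (hc : |c| ≤ X) (hv : ‖v‖ ≤ Y)
    (hcc : |c - c'| ≤ δc) (hvv : ‖v - v'‖ ≤ δv) : ‖c • v - c' • v'‖ ≤ xi X Y δc δv := by
  have h : c • v - c' • v' = c • (v - v') + (c - c') • v - (c - c') • (v - v') := by
    simp only [smul_sub, sub_smul]; abel
  rw [h, xi]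
  refine (norm_sub_le _ _).trans (add_le_add ((norm_add_le _ _).trans (add_le_add ?_ ?_)) ?_)
  · rw [norm_smul, Real.norm_eq_abs]
    exact mul_le_mul hc hvv (norm_nonneg _) ((abs_nonneg c).trans hc)
  · rw [norm_smul, Real.norm_eq_abs, mul_comm]
    exact mul_le_mul hv hcc (abs_nonneg _) ((norm_nonneg v).trans hv)
  · rw [norm_smul, Real.norm_eq_abs]
    exact mul_le_mul hcc hvv (norm_nonneg _) ((abs_nonneg _).trans hcc)

theorem abs_mul_sub_mul_le {c c' δc X Y δv v v' : ℝ} (hc : |c| ≤ X) (hv : |v| ≤ Y)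
    (hcc : |c - c'| ≤ δc) (hvv : |v - v'| ≤ δv) : |c * v - c' * v'| ≤ xi X Y δc δv :=
  norm_smul_sub_smul_le (H := ℝ) hc hv hcc hvv

theorem abs_inner_sub_inner_le {X Y δu δv : ℝ} {u u' v v' : H} (hu : ‖u‖ ≤ X) (hv : ‖v‖ ≤ Y)
    (huu : ‖u - u'‖ ≤ δu) (hvv : ‖v - v'‖ ≤ δv) :
    |inner ℝ u v - inner ℝ u' v'| ≤ xi X Y δu δv := by
  have h : inner ℝ u v - inner ℝ u' v'
      = inner ℝ u (v - v') + inner ℝ (u - u') v - inner ℝ (u - u') (v - v') := by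
    simp only [inner_sub_right, inner_sub_left]; ring
  rw [h, xi]
  refine (abs_sub _ _).trans (add_le_add ((abs_add_le _ _).trans (add_le_add ?_ ?_)) ?_)
  · exact (abs_real_inner_le_norm _ _).trans
      (mul_le_mul hu hvv (norm_nonneg _) ((norm_nonneg _).trans hu))
  · exact (abs_real_inner_le_norm _ _).trans
      ((mul_comm _ _).trans_le (mul_le_mul hv huu (norm_nonneg _) ((norm_nonneg _).trans hv)))
  · exact (abs_real_inner_le_norm _ _).trans
      (mul_le_mul huu hvv (norm_nonneg _) ((norm_nonneg _).trans huu))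

theorem abs_norm_sq_sub_le {δ : ℝ} {u u' : H} (h : ‖u - u'‖ ≤ δ) :
    |‖u‖ ^ 2 - ‖u'‖ ^ 2| ≤ xi ‖u‖ ‖u‖ δ δ := by
  simpa only [real_inner_self_eq_norm_sq] using abs_inner_sub_inner_le le_rfl le_rfl h h

theorem abs_inv_sub_inv_le {x x' δ : ℝ} (h : ZetaDefined x δ) (hx : |x - x'| ≤ δ) :
    |x⁻¹ - x'⁻¹| ≤ zeta x δ := by
  obtain ⟨hδ, hδx⟩ := h
  have hx0 : 0 < x := hδ.trans_lt hδx
  have hx' : x - δ ≤ x' := by linarith [(abs_le.1 hx).2]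
  have hxδ : 0 < x - δ := sub_pos.2 hδx
  have hx'0 : 0 < x' := hxδ.trans_le hx'
  rw [inv_sub_inv hx0.ne' hx'0.ne', abs_div, abs_of_pos (mul_pos hx0 hx'0), abs_sub_comm, zeta]
  gcongr

/-- The state `s` lies within the error bounds `e` of the state `s'`. -/
structure Tracks (s s' : CGState H) (e : ErrState) : Prop where
  g : ‖s.g - s'.g‖ ≤ e.δg
  u : ‖s.u - s'.u‖ ≤ e.δu
  d : ‖s.d - s'.d‖ ≤ e.δd
  sq : |‖s.u‖ ^ 2 - ‖s'.u‖ ^ 2| ≤ e.ε4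

namespace Tracks

variable {s s' : CGState H} {e : ErrState} {S : H → H} {S' : H →ₗ[ℝ] H} {ε : ℝ}

/-- The perturbation `S - S'` acts on the computed direction and the contraction `S'` on the error,
hence `xi'` without a product term. -/
theorem norm_apply_sub_le (h : Tracks s s' e) (hS' : ∀ x, ‖S' x‖ ≤ ‖x‖)
    (hSS' : ∀ x, ‖S x - S' x‖ ≤ ε * ‖x‖) : ‖S s.d - S' s'.d‖ ≤ e.ε1 ε s := by
  have h1 : S s.d - S' s'.d = (S s.d - S' s.d) + S' (s.d - s'.d) := by rw [map_sub]; abel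
  rw [h1]
  refine (norm_add_le _ _).trans ((add_le_add (hSS' _) ((hS' _).trans h.d)).trans_eq ?_)
  rw [ErrState.ε1, xi']; ring

theorem abs_inner_sub_le (h : Tracks s s' e) (hS : ∀ x, ‖S x‖ ≤ ‖x‖) (hS' : ∀ x, ‖S' x‖ ≤ ‖x‖)
    (hSS' : ∀ x, ‖S x - S' x‖ ≤ ε * ‖x‖) :
    |inner ℝ s.d (S s.d) - inner ℝ s'.d (S' s'.d)| ≤ e.ε2 ε s :=
  abs_inner_sub_inner_le le_rfl (hS _) h.d (h.norm_apply_sub_le hS' hSS')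

theorem next (h : Tracks s s' e) (hS : ∀ x, ‖S x‖ ≤ ‖x‖) (hS' : ∀ x, ‖S' x‖ ≤ ‖x‖)
    (hSS' : ∀ x, ‖S x - S' x‖ ≤ ε * ‖x‖) (hex : ¬ e.Exits S ε s) :
    Tracks (s.next S) (s'.next S') (e.next S ε s) := by
  rw [ErrState.Exits, not_or, not_not, not_not] at hex
  obtain ⟨hz3, hz5⟩ := hex
  have hA : 0 < inner ℝ s.d (S s.d) := hz3.1.trans_lt hz3.2
  have h1 := h.norm_apply_sub_le hS' hSS'
  have h2 := h.abs_inner_sub_le hS hS' hSS'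
  have h3 := abs_inv_sub_inv_le hz3 h2
  have hα : |s.α S - s'.α S'| ≤ e.δα S ε s := by
    rw [CGState.α, CGState.α, div_eq_mul_inv, div_eq_mul_inv]
    exact abs_mul_sub_mul_le (abs_of_nonneg (sq_nonneg _)).le
      (abs_of_pos (inv_pos.2 hA)).le h.sq h3
  have hα0 : |s.α S| ≤ s.α S :=
    (abs_of_nonneg (div_nonneg (sq_nonneg _) hA.le)).le
  have hu : ‖s.nextU S - s'.nextU S'‖ ≤ e.nextδu S ε s := by
    have heq : s.nextU S - s'.nextU S'
        = (s.u - s'.u) - (s.α S • S s.d - s'.α S' • S' s'.d) := by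
      simp only [CGState.nextU]; abel
    rw [heq]
    exact (norm_sub_le _ _).trans (add_le_add h.u (norm_smul_sub_smul_le hα0 (hS _) hα h1))
  have h4 : |‖s.nextU S‖ ^ 2 - ‖s'.nextU S'‖ ^ 2| ≤ e.nextε4 S ε s := abs_norm_sq_sub_le hu
  have h5 := abs_inv_sub_inv_le hz5 h.sq
  have hβ : |s.β S - s'.β S'| ≤ e.δβ S ε s := by
    rw [CGState.β, CGState.β, div_eq_mul_inv, div_eq_mul_inv]
    exact abs_mul_sub_mul_le (abs_of_nonneg (sq_nonneg _)).le
      (abs_of_nonneg (inv_nonneg.2 (sq_nonneg _))).le h4 h5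
  have hβ0 : |s.β S| ≤ s.β S := (abs_of_nonneg (div_nonneg (sq_nonneg _) (sq_nonneg _))).le
  refine ⟨?_, hu, ?_, h4⟩
  · have heq : (s.next S).g - (s'.next S').g
        = (s.g - s'.g) + (s.α S • s.d - s'.α S' • s'.d) := by
      simp only [CGState.next]; abel
    rw [heq]
    exact (norm_add_le _ _).trans (add_le_add h.g (norm_smul_sub_smul_le hα0 le_rfl hα h.d))
  · have heq : (s.next S).d - (s'.next S').d
        = (s.nextU S - s'.nextU S') + (s.β S • s.d - s'.β S' • s'.d) := by
      simp only [CGState.next]; abel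
    rw [heq]
    exact (norm_add_le _ _).trans (add_le_add hu (norm_smul_sub_smul_le hβ0 le_rfl hβ h.d))

end Tracks

theorem tracks_cg {S : H → H} {S' : H →ₗ[ℝ] H} {b b' : H} {ε : ℝ} (hS : ∀ x, ‖S x‖ ≤ ‖x‖)
    (hS' : ∀ x, ‖S' x‖ ≤ ‖x‖) (hSS' : ∀ x, ‖S x - S' x‖ ≤ ε * ‖x‖) (hb : ‖b - b'‖ ≤ ε) {m : ℕ}
    (hex : ∀ j < m, ¬ (errorControl S b ε j).Exits S ε (cg S b j)) :
    Tracks (cg S b m) (cg S' b' m) (errorControl S b ε m) := by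
  induction m with
  | zero => exact ⟨by simp [cg, errorControl], hb, hb, abs_norm_sq_sub_le hb⟩
  | succ m ih =>
    exact (ih fun j hj => hex j (by omega)).next hS hS' hSS' (hex m m.lt_succ_self)

open Asymptotics

theorem isBigO_xi {ε x y δx δy : ℕ → ℝ} (hε : Tendsto ε atTop (𝓝 0))
    (hx : x =O[atTop] fun _ => (1 : ℝ)) (hy : y =O[atTop] fun _ => (1 : ℝ))
    (hδx : δx =O[atTop] ε) (hδy : δy =O[atTop] ε) :
    (fun n => xi (x n) (y n) (δx n) (δy n)) =O[atTop] ε := by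
  have h1 := hx.mul hδy
  have h2 := hy.mul hδx
  have h3 := (hδx.trans (hε.isBigO_one ℝ)).mul hδy
  simp only [one_mul] at h1 h2 h3
  exact (h1.add h2).add h3

theorem isBigO_zeta {ε x δ : ℕ → ℝ} {a : ℝ} (hε : Tendsto ε atTop (𝓝 0))
    (hx : Tendsto x atTop (𝓝 a)) (ha : a ≠ 0) (hδ : δ =O[atTop] ε) :
    (fun n => zeta (x n) (δ n)) =O[atTop] ε := by
  have hδ0 := hδ.trans_tendsto hε
  have h1 : Tendsto (fun n => (x n * (x n - δ n))⁻¹) atTop (𝓝 (a * (a - 0))⁻¹) :=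
    (hx.mul (hx.sub hδ0)).inv₀ (by simpa using ha)
  have h2 := hδ.mul (h1.isBigO_one ℝ)
  simpa only [mul_one, zeta, div_eq_mul_inv] using h2

theorem eventually_zetaDefined {x δ : ℕ → ℝ} {a : ℝ} (hx : Tendsto x atTop (𝓝 a)) (ha : 0 < a)
    (hδ : Tendsto δ atTop (𝓝 0)) (hδ0 : ∀ᶠ n in atTop, 0 ≤ δ n) :
    ∀ᶠ n in atTop, ZetaDefined (x n) (δ n) :=
  hδ0.and (hδ.eventually_lt hx ha)

theorem tendsto_of_eventually_norm_sub_le {E : Type*} [NormedAddCommGroup E] {x : ℕ → E} {a : E}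
    {δ : ℕ → ℝ} (hδ : Tendsto δ atTop (𝓝 0)) (h : ∀ᶠ n in atTop, ‖x n - a‖ ≤ δ n) :
    Tendsto x atTop (𝓝 a) :=
  tendsto_iff_norm_sub_tendsto_zero.2
    (squeeze_zero' (Eventually.of_forall fun _ => norm_nonneg _) h hδ)

theorem epsN_nonneg (n : ℕ) : 0 ≤ epsN n := mul_nonneg (by norm_num) (Real.sqrt_nonneg _)

/-- After squaring, the claim is `log n = o(n ^ (1 - 2γ))`; this is where `γ < 1 / 2` enters. -/
theorem epsN_isLittleO {γ : ℝ} (hγ : γ < 1 / 2) :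
    epsN =o[atTop] fun n : ℕ => (n : ℝ) ^ (-γ) := by
  rw [isLittleO_iff]
  intro c hc
  have h := ((isLittleO_log_rpow_atTop (show 0 < 1 - 2 * γ by linarith)).comp_tendsto
    tendsto_natCast_atTop_atTop).bound (show 0 < (c / 4) ^ 2 by positivity)
  filter_upwards [h, eventually_gt_atTop 0] with n hn hn0
  have hn0' : (0 : ℝ) < n := by exact_mod_cast hn0
  simp only [Function.comp_apply, Real.norm_eq_abs] at hn
  rw [abs_of_pos (Real.rpow_pos_of_pos hn0' _)] at hn
  rw [Real.norm_of_nonneg (epsN_nonneg n), Real.norm_of_nonneg (Real.rpow_pos_of_pos hn0' _).le]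
  have h1 : √(Real.log n / n) ≤ c / 4 * (n : ℝ) ^ (-γ) := by
    refine Real.sqrt_le_iff.2 ⟨by positivity, ?_⟩
    rw [div_le_iff₀ hn0', mul_pow, ← Real.rpow_natCast ((n : ℝ) ^ (-γ)), ← Real.rpow_mul hn0'.le,
      mul_assoc, ← Real.rpow_add_one hn0'.ne']
    refine (le_abs_self _).trans (hn.trans_eq ?_)
    congr 2
    push_cast
    ring
  rw [epsN]
  linarith

theorem tendsto_natCast_rpow_neg {γ : ℝ} (hγ : 0 < γ) :
    Tendsto (fun n : ℕ => (n : ℝ) ^ (-γ)) atTop (𝓝 0) :=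
  (tendsto_rpow_neg_atTop hγ).comp tendsto_natCast_atTop_atTop

theorem tendsto_epsN : Tendsto epsN atTop (𝓝 0) :=
  (epsN_isLittleO (γ := 1 / 4) (by norm_num)).isBigO.trans_tendsto
    (tendsto_natCast_rpow_neg (by norm_num))

section Sequences

variable {S : ℕ → H → H} {S' : H →ₗ[ℝ] H} {b : ℕ → H} {b' : H}

/-- The state of the `n`-th conjugate gradient iteration converges to that of the limit iteration,
with errors that are tracked by bounds of order `epsN`. -/
structure TracksAsymptotically (S : ℕ → H → H) (S' : H →ₗ[ℝ] H) (b : ℕ → H) (b' : H) (m : ℕ) :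
    Prop where
  not_exits : ∀ᶠ n in atTop, ∀ j < m,
    ¬ (errorControl (S n) (b n) (epsN n) j).Exits (S n) (epsN n) (cg (S n) (b n) j)
  tracks : ∀ᶠ n in atTop,
    Tracks (cg (S n) (b n) m) (cg S' b' m) (errorControl (S n) (b n) (epsN n) m)
  δg : (fun n => (errorControl (S n) (b n) (epsN n) m).δg) =O[atTop] epsN
  δu : (fun n => (errorControl (S n) (b n) (epsN n) m).δu) =O[atTop] epsN
  δd : (fun n => (errorControl (S n) (b n) (epsN n) m).δd) =O[atTop] epsN
  ε4 : (fun n => (errorControl (S n) (b n) (epsN n) m).ε4) =O[atTop] epsN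

theorem tracksAsymptotically_zero
    (hdev : ∀ᶠ n in atTop, ‖b n - b'‖ ≤ epsN n) : TracksAsymptotically S S' b b' 0 := by
  have hb := (tendsto_of_eventually_norm_sub_le tendsto_epsN hdev).norm.isBigO_one ℝ
  refine ⟨by simp, ?_, ?_, isBigO_refl _ _, isBigO_refl _ _,
    isBigO_xi tendsto_epsN hb hb (isBigO_refl _ _) (isBigO_refl _ _)⟩
  · filter_upwards [hdev] with n hb
    exact ⟨by simp [cg, errorControl], hb, hb, abs_norm_sq_sub_le hb⟩
  · exact isBigO_zero _ _

/-- Both divisors of the pass have positive limits, so `zeta` is eventually defined and all factors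
stay bounded; each monitored quantity is then a fixed expression that preserves the order O(`epsN`).
-/
theorem TracksAsymptotically.succ {m : ℕ} (h : TracksAsymptotically S S' b b' m)
    (hS : ∀ n x, ‖S n x‖ ≤ ‖x‖) (hS' : ∀ x, ‖S' x‖ ≤ ‖x‖)
    (hdev : ∀ᶠ n in atTop, ∀ x, ‖S n x - S' x‖ ≤ epsN n * ‖x‖)
    (hu : (cg S' b' m).u ≠ 0) (hA : 0 < inner ℝ (cg S' b' m).d (S' (cg S' b' m).d)) :
    TracksAsymptotically S S' b b' (m + 1) := by
  have hε := tendsto_epsN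
  set s : ℕ → CGState H := fun n => cg (S n) (b n) m with hs
  set e : ℕ → ErrState := fun n => errorControl (S n) (b n) (epsN n) m with he
  set s' : CGState H := cg S' b' m with hs'
  have htr : ∀ᶠ n in atTop, Tracks (s n) s' (e n) := h.tracks
  have hδd : (fun n => (e n).δd) =O[atTop] epsN := h.δd
  have hδu : (fun n => (e n).δu) =O[atTop] epsN := h.δu
  have hδg : (fun n => (e n).δg) =O[atTop] epsN := h.δg
  have hε4 : (fun n => (e n).ε4) =O[atTop] epsN := h.ε4
  have hd : Tendsto (fun n => ‖(s n).d‖) atTop (𝓝 ‖s'.d‖) :=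
    (tendsto_of_eventually_norm_sub_le (hδd.trans_tendsto hε) (htr.mono fun _ h => h.d)).norm
  have hd1 := hd.isBigO_one ℝ
  have hu2 : Tendsto (fun n => ‖(s n).u‖ ^ 2) atTop (𝓝 (‖s'.u‖ ^ 2)) :=
    (tendsto_of_eventually_norm_sub_le (hδu.trans_tendsto hε) (htr.mono fun _ h => h.u)).norm.pow 2
  have hu2pos : 0 < ‖s'.u‖ ^ 2 := pow_pos (norm_pos_iff.2 hu) 2
  have hε1 : (fun n => (e n).ε1 (epsN n) (s n)) =O[atTop] epsN := by
    have h1 := hd1.mul (isBigO_refl epsN atTop)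
    simp only [one_mul] at h1
    simpa only [ErrState.ε1, xi', one_mul] using h1.add hδd
  have hε2 : (fun n => (e n).ε2 (epsN n) (s n)) =O[atTop] epsN := isBigO_xi hε hd1 hd1 hδd hε1
  have hA2 : ∀ᶠ n in atTop, |inner ℝ (s n).d (S n (s n).d) - inner ℝ s'.d (S' s'.d)|
      ≤ (e n).ε2 (epsN n) (s n) := by
    filter_upwards [htr, hdev] with n hn hdn
    exact hn.abs_inner_sub_le (hS n) hS' hdn
  have hAlim : Tendsto (fun n => inner ℝ (s n).d (S n (s n).d)) atTop
      (𝓝 (inner ℝ s'.d (S' s'.d))) :=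
    tendsto_of_eventually_norm_sub_le (hε2.trans_tendsto hε) hA2
  -- The error bound is nonnegative because it dominates an absolute value.
  have hz3 := eventually_zetaDefined hAlim hA (hε2.trans_tendsto hε)
    (hA2.mono fun _ h => (abs_nonneg _).trans h)
  have hz5 := eventually_zetaDefined hu2 hu2pos (hε4.trans_tendsto hε)
    (htr.mono fun _ h => (abs_nonneg _).trans h.sq)
  have hnex : ∀ᶠ n in atTop, ¬ (e n).Exits (S n) (epsN n) (s n) := by
    filter_upwards [hz3, hz5] with n h3 h5
    exact not_or.2 ⟨not_not.2 h3, not_not.2 h5⟩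
  have htr' : ∀ᶠ n in atTop, Tracks ((s n).next (S n)) (s'.next S')
      ((e n).next (S n) (epsN n) (s n)) := by
    filter_upwards [htr, hdev, hnex] with n hn hdn hex
    exact hn.next (hS n) hS' hdn hex
  have hε3 : (fun n => (e n).ε3 (S n) (epsN n) (s n)) =O[atTop] epsN :=
    isBigO_zeta hε hAlim hA.ne' hε2
  have hε5 : (fun n => (e n).ε5 (s n)) =O[atTop] epsN := isBigO_zeta hε hu2 hu2pos.ne' hε4
  have hδα : (fun n => (e n).δα (S n) (epsN n) (s n)) =O[atTop] epsN :=
    isBigO_xi hε (hu2.isBigO_one ℝ) ((hAlim.inv₀ hA.ne').isBigO_one ℝ) hε4 hε3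
  have hα : (fun n => (s n).α (S n)) =O[atTop] fun _ => (1 : ℝ) :=
    (hu2.div hAlim hA.ne').isBigO_one ℝ
  have hδg' : (fun n => (e n).nextδg (S n) (epsN n) (s n)) =O[atTop] epsN :=
    hδg.add (isBigO_xi hε hα hd1 hδα hδd)
  have hδu' : (fun n => (e n).nextδu (S n) (epsN n) (s n)) =O[atTop] epsN :=
    hδu.add (isBigO_xi hε hα hd1 hδα hε1)
  have hu' : Tendsto (fun n => ‖(s n).nextU (S n)‖) atTop (𝓝 ‖s'.nextU S'‖) :=
    (tendsto_of_eventually_norm_sub_le (hδu'.trans_tendsto hε) (htr'.mono fun _ h => h.u)).norm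
  have hε4' : (fun n => (e n).nextε4 (S n) (epsN n) (s n)) =O[atTop] epsN :=
    isBigO_xi hε (hu'.isBigO_one ℝ) (hu'.isBigO_one ℝ) hδu' hδu'
  have hδβ : (fun n => (e n).δβ (S n) (epsN n) (s n)) =O[atTop] epsN :=
    isBigO_xi hε ((hu'.pow 2).isBigO_one ℝ) ((hu2.inv₀ hu2pos.ne').isBigO_one ℝ) hε4' hε5
  have hβ : (fun n => (s n).β (S n)) =O[atTop] fun _ => (1 : ℝ) :=
    ((hu'.pow 2).div hu2 hu2pos.ne').isBigO_one ℝ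
  have hδd' : (fun n => (e n).nextδd (S n) (epsN n) (s n)) =O[atTop] epsN :=
    hδu'.add (isBigO_xi hε hβ hd1 hδβ hδd)
  refine ⟨?_, htr', hδg', hδu', hδd', hε4'⟩
  filter_upwards [h.not_exits, hnex] with n h1 h2 j hj
  rcases Nat.lt_succ_iff_lt_or_eq.1 hj with hj | rfl
  · exact h1 j hj
  · exact h2

/-- Existence of a stopping index is needed because `sInf ∅ = 0` in `ℕ`. -/
theorem le_stoppingStep {S : H → H} {b : H} {n : ℕ} {γ : ℝ} {m : ℕ}
    (hne : ∃ m, StopsAt S b n γ m) (h : ∀ j < m, ¬ StopsAt S b n γ j) :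
    m ≤ stoppingStep S b n γ := by
  by_contra! hlt
  exact h _ hlt (Nat.sInf_mem hne)

/-- The bound for the selected iterate was checked in the preceding pass, at which the rule did not
stop; at step `0` both iterates are zero. -/
theorem norm_cg_stoppingStep_sub_le {S : H → H} {S' : H →ₗ[ℝ] H} {b b' : H} {n : ℕ} {γ : ℝ}
    (hS : ∀ x, ‖S x‖ ≤ ‖x‖) (hS' : ∀ x, ‖S' x‖ ≤ ‖x‖)
    (hSS' : ∀ x, ‖S x - S' x‖ ≤ epsN n * ‖x‖) (hb : ‖b - b'‖ ≤ epsN n) :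
    ‖(cg S b (stoppingStep S b n γ)).g - (cg S' b' (stoppingStep S b n γ)).g‖
      ≤ (n : ℝ) ^ (-γ) := by
  have hns : ∀ j < stoppingStep S b n γ, ¬ StopsAt S b n γ j := fun j hj =>
    Nat.notMem_of_lt_sInf hj
  have htr := tracks_cg hS hS' hSS' hb fun j hj => (not_or.1 (hns j hj)).1
  refine htr.g.trans ?_
  cases hk : stoppingStep S b n γ with
  | zero => exact Real.rpow_nonneg n.cast_nonneg _
  | succ k => exact not_lt.1 (not_or.1 (hns k (by omega))).2

/-- A pass that does not exit has nonzero residual and positive curvature, so never stopping would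
contradict finite termination. -/
theorem exists_stopsAt {S : H →ₗ[ℝ] H} (hS : S.IsSymmetric) {b : H} (V : Submodule ℝ H)
    [FiniteDimensional ℝ V] (hSV : ∀ x, S x ∈ V) (hb : b ∈ V) (n : ℕ) (γ : ℝ) :
    ∃ m, StopsAt S b n γ m := by
  obtain ⟨M, hM⟩ := exists_not_regular hS V hSV hb
  by_contra! h
  refine hM fun j _ => ?_
  have hj := (not_or.1 (h j)).1
  rw [ErrState.Exits, not_or, not_not, not_not] at hj
  refine ⟨fun h0 => ?_, (hj.1.1.trans_lt hj.1.2).ne'⟩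
  have := hj.2.1.trans_lt hj.2.2
  simp [h0] at this

variable {G : Type*} [NormedAddCommGroup G] [InnerProductSpace ℝ G] [CompleteSpace G]
  [CompleteSpace H] {T : H →L[ℝ] G} {f : G}

theorem norm_normalOp_le (hT : ∀ x, ‖T x‖ ≤ ‖x‖) (x : H) : ‖normalOp T x‖ ≤ ‖x‖ := by
  have hT1 : ‖T‖ ≤ 1 := T.opNorm_le_bound zero_le_one fun x => by simpa using hT x
  have h := T.adjoint.le_of_opNorm_le (by simpa using hT1 : ‖T.adjoint‖ ≤ 1) (T x)
  rw [normalOp_apply]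
  linarith [hT x]

theorem tracksAsymptotically_normal (hT : ∀ x, ‖T x‖ ≤ ‖x‖) (hS : ∀ n x, ‖S n x‖ ≤ ‖x‖)
    (hdev : ∀ᶠ n in atTop, ∀ x, ‖S n x - normalOp T x‖ ≤ epsN n * ‖x‖)
    (hb : ∀ᶠ n in atTop, ‖b n - T.adjoint f‖ ≤ epsN n) {m : ℕ}
    (hu : ∀ j < m, (cg (normalOp T) (T.adjoint f) j).u ≠ 0) :
    TracksAsymptotically S (normalOp T) b (T.adjoint f) m := by
  induction m with
  | zero => exact tracksAsymptotically_zero hb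
  | succ m ih =>
    exact (ih fun j hj => hu j (by omega)).succ hS (norm_normalOp_le hT) hdev
      (hu m m.lt_succ_self) (inner_self_normal_pos T f fun j hj => hu j (by omega))

theorem eventually_not_stopsAt (hT : ∀ x, ‖T x‖ ≤ ‖x‖) (hS : ∀ n x, ‖S n x‖ ≤ ‖x‖)
    (hdev : ∀ᶠ n in atTop, ∀ x, ‖S n x - normalOp T x‖ ≤ epsN n * ‖x‖)
    (hb : ∀ᶠ n in atTop, ‖b n - T.adjoint f‖ ≤ epsN n) {γ : ℝ} (hγ : γ < 1 / 2) {m : ℕ}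
    (hu : ∀ j < m, (cg (normalOp T) (T.adjoint f) j).u ≠ 0) :
    ∀ᶠ n in atTop, ∀ j < m, ¬ StopsAt (S n) (b n) n γ j := by
  have hstep : ∀ j ∈ Finset.range m, ∀ᶠ n in atTop, ¬ StopsAt (S n) (b n) n γ j := by
    intro j hj
    have hj := Finset.mem_range.1 hj
    -- Stopping at `j` concerns the exit of pass `j` and the bound for iterate `j + 1`.
    have h := tracksAsymptotically_normal hT hS hdev hb (m := j + 1) fun i hi => hu i (by omega)
    have hlt := (h.δg.trans_isLittleO (epsN_isLittleO hγ)).bound one_pos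
    filter_upwards [h.not_exits, hlt] with n h1 h2
    rw [StopsAt, not_or, not_lt]
    refine ⟨h1 j j.lt_succ_self, ?_⟩
    rw [one_mul, Real.norm_of_nonneg (Real.rpow_nonneg n.cast_nonneg _)] at h2
    exact (le_abs_self _).trans h2
  filter_upwards [(eventually_all_finset _).2 hstep] with n hn j hj
  exact hn j (Finset.mem_range.2 hj)

/-- Consistency of conjugate gradients with the error monitoring stopping rule, for operators and
right-hand sides that converge at the rate `epsN`. -/
theorem tendsto_cg_stoppingStep (hT : ∀ x, ‖T x‖ ≤ ‖x‖) (hTd : DenseRange T)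
    (hS : ∀ n x, ‖S n x‖ ≤ ‖x‖)
    (hdev : ∀ᶠ n in atTop, ∀ x, ‖S n x - normalOp T x‖ ≤ epsN n * ‖x‖)
    (hb : ∀ᶠ n in atTop, ‖b n - T.adjoint f‖ ≤ epsN n) {γ : ℝ} (hγ₀ : 0 < γ) (hγ : γ < 1 / 2)
    (hne : ∀ n, ∃ m, StopsAt (S n) (b n) n γ m) :
    Tendsto (fun n => T (cg (S n) (b n) (stoppingStep (S n) (b n) n γ)).g) atTop (𝓝 f) := by
  set k : ℕ → ℕ := fun n => stoppingStep (S n) (b n) n γ with hk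
  have hdiff : Tendsto (fun n => T (cg (S n) (b n) (k n)).g
      - T (cg (normalOp T) (T.adjoint f) (k n)).g) atTop (𝓝 0) := by
    refine tendsto_of_eventually_norm_sub_le (tendsto_natCast_rpow_neg hγ₀) ?_
    filter_upwards [hdev, hb] with n h1 h2
    rw [sub_zero, ← map_sub]
    exact (hT _).trans (norm_cg_stoppingStep_sub_le (hS n) (norm_normalOp_le hT) h1 h2)
  suffices hlim : Tendsto (fun n => T (cg (normalOp T) (T.adjoint f) (k n)).g) atTop (𝓝 f) by
    simpa using hdiff.add hlim
  have hge : ∀ m, (∀ j < m, (cg (normalOp T) (T.adjoint f) j).u ≠ 0) →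
      ∀ᶠ n in atTop, m ≤ k n := fun m hm => by
    filter_upwards [eventually_not_stopsAt hT hS hdev hb hγ hm] with n hn
    exact le_stoppingStep (hne n) hn
  -- Either the stopping step diverges along an infinite population iteration, or that iteration
  -- terminates and the stopping step is eventually its terminal index.
  by_cases hu : ∀ m, (cg (normalOp T) (T.adjoint f) m).u ≠ 0
  · exact (tendsto_apply_cg hTd hu).comp (tendsto_atTop.2 fun m => hge m fun j _ => hu j)
  · push Not at hu
    classical
    set m := Nat.find hu with hm
    have hm0 : (cg (normalOp T) (T.adjoint f) m).u = 0 := Nat.find_spec hu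
    have hmin : ∀ j < m, (cg (normalOp T) (T.adjoint f) j).u ≠ 0 := fun j hj =>
      Nat.find_min hu hj
    refine tendsto_const_nhds.congr' ?_
    filter_upwards [hge m hmin, (tracksAsymptotically_normal hT hS hdev hb hmin).tracks]
      with n h1 h2
    -- The population residual is zero, so the empirical `‖u‖ ^ 2` is at most its own error bound
    -- and `ε5` is undefined.
    have hstops : StopsAt (S n) (b n) n γ m := by
      refine Or.inl (Or.inr fun hz => ?_)
      have h3 := h2.sq
      rw [hm0, norm_zero] at h3
      have h4 := hz.2
      rw [abs_of_nonneg (by simp)] at h3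
      linarith
    have heq : k n = m := le_antisymm (Nat.sInf_le hstops) h1
    rw [heq, apply_cg_eq_of_u_eq_zero hTd hm0]

end Sequences

end ErrorControl

/-! ### Closure properties of weak measurability. -/

section Measurability

variable {E : Type*} [NormedAddCommGroup E] [InnerProductSpace ℝ E]
  {𝒵 : Type*} [MeasurableSpace 𝒵]

theorem measurable_inner_of_dense {ξ : 𝒵 → E} {D : Set E} (hD : Dense D)
    (h : ∀ v ∈ D, Measurable fun z => inner ℝ v (ξ z)) (v : E) :
    Measurable fun z => inner ℝ v (ξ z) := by
  obtain ⟨w, hwD, hw⟩ := mem_closure_iff_seq_limit.1 (hD v)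
  exact measurable_of_tendsto_metrizable (fun n => h _ (hwD n))
    (tendsto_pi_nhds.2 fun z => hw.inner tendsto_const_nhds)

theorem WeaklyMeasurable.comp {𝒲 : Type*} [MeasurableSpace 𝒲] {ξ : 𝒵 → E} (hξ : WeaklyMeasurable ξ)
    {φ : 𝒲 → 𝒵} (hφ : Measurable φ) : WeaklyMeasurable fun w => ξ (φ w) where
  inner_left h := (hξ.inner_left h).comp hφ
  inner_self := hξ.inner_self.comp (f := fun p : 𝒲 × 𝒲 => (φ p.1, φ p.2))
    ((hφ.comp measurable_fst).prodMk (hφ.comp measurable_snd))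

theorem WeaklyMeasurable.smul {ξ : 𝒵 → E} (hξ : WeaklyMeasurable ξ)
    {c : 𝒵 → ℝ} (hc : Measurable c) : WeaklyMeasurable fun z => c z • ξ z where
  inner_left h := by
    simp only [inner_smul_right]
    exact hc.mul (hξ.inner_left h)
  inner_self := by
    simp only [inner_smul_right, real_inner_smul_left]
    exact (hc.comp measurable_snd).mul ((hc.comp measurable_fst).mul hξ.inner_self)

end Measurability

/-! ### The feature map and its tensor square. -/

section Feature

variable {𝒳 : Type*} {H : Type*} [NormedAddCommGroup H] [InnerProductSpace ℝ H]
  [CompleteSpace H] [RKHS ℝ H 𝒳 ℝ]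

theorem inner_feature (g : H) (x : 𝒳) : inner ℝ g (feature H x) = g x := by
  simp [feature]

theorem feature_inner (g : H) (x : 𝒳) : inner ℝ (feature H x) g = g x := by
  rw [real_inner_comm, inner_feature]

theorem inner_feature_feature (x x' : 𝒳) :
    inner ℝ (feature H x) (feature H x') = ker H x' x := by
  rw [inner_feature, feature, RKHS.kerFun_apply, ker]

theorem norm_feature_le (hk : ∀ x : 𝒳, ker H x x ≤ 1) (x : 𝒳) : ‖feature H x‖ ≤ 1 := by
  have h := inner_feature_feature (H := H) x x
  rw [real_inner_self_eq_norm_sq] at h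
  exact (sq_le_one_iff₀ (norm_nonneg _)).1 (h.trans_le (hk x))

theorem abs_apply_le (hk : ∀ x : 𝒳, ker H x x ≤ 1) (g : H) (x : 𝒳) : |g x| ≤ ‖g‖ := by
  rw [← inner_feature]
  exact (abs_real_inner_le_norm _ _).trans
    (mul_le_of_le_one_right (norm_nonneg _) (norm_feature_le hk x))

open scoped TensorProduct

/-- The rank one operator `k(x, ·) ⊗ k(x, ·)`, in the Hilbert space tensor square of `H`. -/
noncomputable def featureSq (H : Type*) [NormedAddCommGroup H] [InnerProductSpace ℝ H]
    [CompleteSpace H] [RKHS ℝ H 𝒳 ℝ] (x : 𝒳) :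
    UniformSpace.Completion (H ⊗[ℝ] H) :=
  ((feature H x ⊗ₜ[ℝ] feature H x : H ⊗[ℝ] H) : UniformSpace.Completion (H ⊗[ℝ] H))

/-- Averages of `featureSq` thus encode covariance operators in Hilbert–Schmidt norm, so one
vector-valued concentration bound controls all `g` at once. -/
theorem inner_tmul_featureSq (g h : H) (x : 𝒳) :
    inner ℝ ((g ⊗ₜ[ℝ] h : H ⊗[ℝ] H) : UniformSpace.Completion (H ⊗[ℝ] H)) (featureSq H x)
      = g x * h x := by
  rw [featureSq, UniformSpace.Completion.inner_coe, TensorProduct.inner_tmul, inner_feature,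
    inner_feature]

theorem norm_featureSq_le (hk : ∀ x : 𝒳, ker H x x ≤ 1) (x : 𝒳) : ‖featureSq H x‖ ≤ 1 := by
  rw [featureSq, UniformSpace.Completion.norm_coe, TensorProduct.norm_tmul]
  exact mul_le_one₀ (norm_feature_le hk x) (norm_nonneg _) (norm_feature_le hk x)

variable [MeasurableSpace 𝒳]

theorem weaklyMeasurable_feature (hk : Measurable fun p : 𝒳 × 𝒳 => ker H p.1 p.2) :
    WeaklyMeasurable (feature H : 𝒳 → H) where
  inner_left := by
    -- Measurability is checked on the span of the kernel sections, where it is joint measurability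
    -- of the kernel, and passes to pointwise limits.
    have hd : Dense (Submodule.span ℝ {RKHS.kerFun H x v | (x : 𝒳) (v : ℝ)} : Set H) :=
      Submodule.dense_iff_topologicalClosure_eq_top.2 (RKHS.kerFun_dense H)
    refine measurable_inner_of_dense hd fun v hv => ?_
    induction hv using Submodule.span_induction with
    | mem v hv =>
      obtain ⟨x, c, rfl⟩ := hv
      have h : RKHS.kerFun H x c = c • feature H x := by
        rw [feature, ← map_smul, smul_eq_mul, mul_one]
      simp only [h, real_inner_smul_left, inner_feature_feature]
      exact (hk.comp (measurable_id.prodMk measurable_const)).const_mul c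
    | zero => simp only [inner_zero_left]; exact measurable_const
    | add v w _ _ hv hw => simp only [inner_add_left]; exact hv.add hw
    | smul c v _ hv => simp only [real_inner_smul_left]; exact hv.const_mul c
  inner_self := by
    simp only [inner_feature_feature]
    exact hk.comp (f := fun p : 𝒳 × 𝒳 => (p.2, p.1)) (measurable_snd.prodMk measurable_fst)

theorem measurable_coe (hk : Measurable fun p : 𝒳 × 𝒳 => ker H p.1 p.2) (g : H) :
    Measurable (g : 𝒳 → ℝ) := by
  simpa only [inner_feature] using (weaklyMeasurable_feature hk).inner_left g

theorem weaklyMeasurable_featureSq (hk : Measurable fun p : 𝒳 × 𝒳 => ker H p.1 p.2) :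
    WeaklyMeasurable (featureSq H : 𝒳 → UniformSpace.Completion (H ⊗[ℝ] H)) where
  inner_left := by
    refine measurable_inner_of_dense UniformSpace.Completion.denseRange_coe ?_
    rintro _ ⟨t, rfl⟩
    induction t using TensorProduct.induction_on with
    | zero => simp only [UniformSpace.Completion.coe_zero, inner_zero_left]; exact measurable_const
    | tmul g h =>
      simp only [inner_tmul_featureSq]
      exact (measurable_coe hk g).mul (measurable_coe hk h)
    | add s t hs ht =>
      simp only [UniformSpace.Completion.coe_add, inner_add_left]
      exact hs.add ht
  inner_self := by
    have h := (weaklyMeasurable_feature hk).inner_self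
    simp only [featureSq, UniformSpace.Completion.inner_coe, TensorProduct.inner_tmul]
    exact h.mul h

end Feature

/-! ### The empirical covariance operator. -/

section Empirical

variable {𝒳 : Type*} {H : Type*} [NormedAddCommGroup H] [InnerProductSpace ℝ H]
  [CompleteSpace H] [RKHS ℝ H 𝒳 ℝ] {n : ℕ}

theorem inner_empCov (x : Fin n → 𝒳) (g h : H) :
    inner ℝ (empCov x g) h = (n : ℝ)⁻¹ * ∑ i, g (x i) * h (x i) := by
  rw [empCov, empAdjoint, real_inner_smul_left, sum_inner]
  simp only [real_inner_smul_left, feature_inner]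

/-- The empirical covariance operator as a linear map. -/
noncomputable def empCovLinear (x : Fin n → 𝒳) : H →ₗ[ℝ] H where
  toFun := empCov x
  map_add' g h := ext_inner_right ℝ fun v => by
    simp only [inner_add_left, inner_empCov, RKHS.coe_add, Pi.add_apply, add_mul,
      Finset.sum_add_distrib, mul_add]
  map_smul' c g := ext_inner_right ℝ fun v => by
    simp only [real_inner_smul_left, inner_empCov, RKHS.coe_smul, Pi.smul_apply, smul_eq_mul,
      RingHom.id_apply, mul_assoc, ← Finset.mul_sum]
    ring

theorem empCovLinear_isSymmetric (x : Fin n → 𝒳) :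
    (empCovLinear x : H →ₗ[ℝ] H).IsSymmetric := fun g h => by
  change inner ℝ (empCov x g) h = inner ℝ g (empCov x h)
  rw [real_inner_comm (empCov x h) g, inner_empCov, inner_empCov]
  simp only [mul_comm]

theorem norm_empCov_le (hk : ∀ x : 𝒳, ker H x x ≤ 1) (x : Fin n → 𝒳) (g : H) :
    ‖empCov x g‖ ≤ ‖g‖ := by
  rcases Nat.eq_zero_or_pos n with rfl | hn
  · simp [empCov, empAdjoint]
  have hn' : (0 : ℝ) < n := by exact_mod_cast hn
  rw [empCov, empAdjoint, norm_smul, norm_inv, Real.norm_of_nonneg hn'.le, inv_mul_le_iff₀ hn']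
  have h := norm_sum_le_of_le (f := fun i => g (x i) • feature H (x i)) (n := fun _ => ‖g‖)
    Finset.univ fun i _ => by
    rw [norm_smul]
    exact (mul_le_of_le_one_right (norm_nonneg _) (norm_feature_le hk _)).trans
      (abs_apply_le hk g _)
  simpa using h

theorem exists_stopsAt_emp (x : Fin n → 𝒳) (y : Fin n → ℝ) (k : ℕ) (γ : ℝ) :
    ∃ m, StopsAt (empCov x) (empAdjoint x y : H) k γ m := by
  have hmem : ∀ v : Fin n → ℝ, (empAdjoint x v : H) ∈
      Submodule.span ℝ (Set.range fun i => feature H (x i)) := fun v =>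
    Submodule.smul_mem _ _ (Submodule.sum_mem _ fun i _ =>
      Submodule.smul_mem _ _ (Submodule.subset_span ⟨i, rfl⟩))
  have := FiniteDimensional.span_of_finite ℝ (Set.finite_range fun i => feature H (x i))
  exact exists_stopsAt (empCovLinear_isSymmetric x) _ (fun g => hmem _) (hmem y) k γ

end Empirical

/-! ### The inclusion into L², and almost sure deviation bounds. -/

section Population

/-- Bounds an operator by its Hilbert–Schmidt norm: it is applied with `v` the operator deviation at
`g`, `B h = g ⊗ h` and `t` the deviation in the tensor square. -/
theorem norm_le_of_inner_self_eq {E F : Type*} [NormedAddCommGroup E] [InnerProductSpace ℝ E]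
    [NormedAddCommGroup F] [InnerProductSpace ℝ F] {v : E} {t : F} {ε C : ℝ} (B : E → F)
    (hC : 0 ≤ C) (hB : ‖B v‖ ≤ C * ‖v‖) (ht : ‖t‖ ≤ ε) (h : inner ℝ v v = inner ℝ (B v) t) :
    ‖v‖ ≤ ε * C := by
  rcases (norm_nonneg v).eq_or_lt with h0 | h0
  · rw [← h0]
    exact mul_nonneg ((norm_nonneg t).trans ht) hC
  refine le_of_mul_le_mul_right ?_ h0
  calc ‖v‖ * ‖v‖ = inner ℝ (B v) t := by rw [← h, real_inner_self_eq_norm_mul_norm]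
    _ ≤ ‖B v‖ * ‖t‖ := real_inner_le_norm _ _
    _ ≤ (C * ‖v‖) * ε := mul_le_mul hB ht (norm_nonneg _) (by positivity)
    _ = ε * C * ‖v‖ := by ring

variable {𝒳 : Type*} [MeasurableSpace 𝒳] {H : Type*} [NormedAddCommGroup H]
  [InnerProductSpace ℝ H] [CompleteSpace H] [RKHS ℝ H 𝒳 ℝ]

theorem memLp_coe (hkm : Measurable fun p : 𝒳 × 𝒳 => ker H p.1 p.2)
    (hk : ∀ x : 𝒳, ker H x x ≤ 1) (Q : Measure 𝒳) [IsFiniteMeasure Q] (g : H) :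
    MemLp (g : 𝒳 → ℝ) 2 Q :=
  MemLp.of_bound (measurable_coe hkm g).aestronglyMeasurable ‖g‖
    (Eventually.of_forall fun x => abs_apply_le hk g x)

theorem norm_toLp_coe_le (hkm : Measurable fun p : 𝒳 × 𝒳 => ker H p.1 p.2)
    (hk : ∀ x : 𝒳, ker H x x ≤ 1) (Q : Measure 𝒳) [IsProbabilityMeasure Q] (g : H) :
    ‖(memLp_coe hkm hk Q g).toLp g‖ ≤ ‖g‖ := by
  have h := Lp.norm_le_of_ae_bound (f := (memLp_coe hkm hk Q g).toLp g) (norm_nonneg g) (by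
    filter_upwards [(memLp_coe hkm hk Q g).coeFn_toLp] with x hx
    rw [hx]
    exact abs_apply_le hk g x)
  have hQ : measureUnivNNReal Q = 1 := by simp [measureUnivNNReal]
  rw [hQ, NNReal.coe_one, Real.one_rpow, one_mul] at h
  exact h

/-- The inclusion of the reproducing kernel Hilbert space into `L²(Q)`. -/
noncomputable def inclusion (hkm : Measurable fun p : 𝒳 × 𝒳 => ker H p.1 p.2)
    (hk : ∀ x : 𝒳, ker H x x ≤ 1) (Q : Measure 𝒳) [IsProbabilityMeasure Q] :
    H →L[ℝ] Lp ℝ 2 Q :=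
  LinearMap.mkContinuous
    { toFun := fun g => (memLp_coe hkm hk Q g).toLp g
      map_add' := fun g h => by
        rw [← MemLp.toLp_add]
        exact MemLp.toLp_congr _ _ (by rw [RKHS.coe_add])
      map_smul' := fun c g => by
        rw [RingHom.id_apply, ← MemLp.toLp_const_smul]
        exact MemLp.toLp_congr _ _ (by rw [RKHS.coe_smul]) }
    1 fun g => by
      rw [one_mul]
      exact norm_toLp_coe_le hkm hk Q g

variable (hkm : Measurable fun p : 𝒳 × 𝒳 => ker H p.1 p.2) (hk : ∀ x : 𝒳, ker H x x ≤ 1)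

theorem inclusion_apply (Q : Measure 𝒳) [IsProbabilityMeasure Q] (g : H) :
    inclusion hkm hk Q g = (memLp_coe hkm hk Q g).toLp g := rfl

theorem denseRange_inclusion (hu : IsUniversal (𝒳 := 𝒳) H) (Q : Measure 𝒳)
    [IsProbabilityMeasure Q] : DenseRange (inclusion hkm hk Q) := by
  refine (hu Q inferInstance).mono ?_
  rintro f ⟨g, hg⟩
  exact ⟨g, Lp.ext ((memLp_coe hkm hk Q g).coeFn_toLp.trans hg.symm)⟩

theorem inner_toLp_inclusion (Q : Measure 𝒳) [IsProbabilityMeasure Q] {f : 𝒳 → ℝ}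
    (hf : MemLp f 2 Q) (g : H) :
    inner ℝ (hf.toLp f) (inclusion hkm hk Q g) = ∫ x, f x * g x ∂Q := by
  rw [L2.inner_def]
  refine integral_congr_ae ?_
  filter_upwards [hf.coeFn_toLp, (memLp_coe hkm hk Q g).coeFn_toLp] with x h1 h2
  rw [inclusion_apply, h1, h2]
  simp [mul_comm]

theorem inner_normalOp_inclusion (Q : Measure 𝒳) [IsProbabilityMeasure Q] (g h : H) :
    inner ℝ (normalOp (inclusion hkm hk Q) g) h = ∫ x, g x * h x ∂Q := by
  rw [real_inner_comm, inner_normalOp, real_inner_comm, inclusion_apply hkm hk Q g,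
    inner_toLp_inclusion]

variable (P : Measure (𝒳 × ℝ)) [IsProbabilityMeasure P] {Ω : Type*} [MeasurableSpace Ω]
  (μ : Measure Ω) [IsProbabilityMeasure μ] {X : ℕ → Ω → 𝒳} {Y : ℕ → Ω → ℝ}

theorem ae_eventually_norm_empCov_sub_le
    (hXY : ∀ i, Measurable fun ω => (X i ω, Y i ω))
    (hlaw : ∀ i, μ.map (fun ω => (X i ω, Y i ω)) = P)
    (hindep : iIndepFun (fun i ω => (X i ω, Y i ω)) μ) :
    ∀ᵐ ω ∂μ, ∀ᶠ n : ℕ in atTop, ∀ g : H,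
      ‖empCov (fun i : Fin n => X i ω) g - normalOp (inclusion hkm hk P.fst) g‖
        ≤ epsN n * ‖g‖ := by
  obtain ⟨M, hM, hae⟩ := ae_eventually_norm_mean_sub_le μ P hXY hlaw hindep
    ((weaklyMeasurable_featureSq hkm).comp measurable_fst) fun z => norm_featureSq_le hk z.1
  filter_upwards [hae] with ω hω
  filter_upwards [hω] with n hn g
  refine norm_le_of_inner_self_eq
    (fun h => (TensorProduct.tmul ℝ g h : UniformSpace.Completion (TensorProduct ℝ H H)))
    (norm_nonneg g) ?_ hn ?_
  · rw [UniformSpace.Completion.norm_coe, TensorProduct.norm_tmul]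
  · have key : ∀ h : H,
        inner ℝ (empCov (fun i : Fin n => X i ω) g - normalOp (inclusion hkm hk P.fst) g) h
          = inner ℝ (TensorProduct.tmul ℝ g h :
              UniformSpace.Completion (TensorProduct ℝ H H))
            ((n : ℝ)⁻¹ • ∑ i : Fin n, featureSq H (X i ω) - M) := fun h => by
      rw [inner_sub_left, inner_empCov, inner_normalOp_inclusion, inner_sub_right,
        inner_smul_right, inner_sum, hM, Measure.fst, integral_map
          (f := fun x => g x * h x) measurable_fst.aemeasurable
          ((measurable_coe hkm g).mul (measurable_coe hkm h)).aestronglyMeasurable]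
      simp only [inner_tmul_featureSq]
    exact key _

theorem ae_mem_Icc_condKernel (hY : ∀ᵐ z ∂P, z.2 ∈ Set.Icc (-1 : ℝ) 1) :
    ∀ᵐ x ∂P.fst, ∀ᵐ y ∂P.condKernel x, y ∈ Set.Icc (-1 : ℝ) 1 := by
  rw [← P.disintegrate P.condKernel] at hY
  exact Measure.ae_ae_of_ae_compProd hY

theorem integrable_snd (hY : ∀ᵐ z ∂P, z.2 ∈ Set.Icc (-1 : ℝ) 1) :
    Integrable (fun z : 𝒳 × ℝ => z.2) P :=
  Integrable.of_bound measurable_snd.aestronglyMeasurable 1 (hY.mono fun _ h => abs_le.2 h)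

theorem memLp_regression (hY : ∀ᵐ z ∂P, z.2 ∈ Set.Icc (-1 : ℝ) 1) :
    MemLp (regression P) 2 P.fst := by
  refine MemLp.of_bound (integrable_snd P hY).integral_condKernel.aestronglyMeasurable 1 ?_
  filter_upwards [ae_mem_Icc_condKernel P hY] with x hx
  have h := norm_integral_le_of_norm_le_const (μ := P.condKernel x) (f := fun y : ℝ => y) (C := 1)
    (hx.mono fun _ h => abs_le.2 h)
  rw [probReal_univ, mul_one] at h
  exact h

theorem integral_regression_mul (hkm : Measurable fun p : 𝒳 × 𝒳 => ker H p.1 p.2)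
    (hk : ∀ x : 𝒳, ker H x x ≤ 1) (P : Measure (𝒳 × ℝ)) [IsProbabilityMeasure P]
    (hY : ∀ᵐ z ∂P, z.2 ∈ Set.Icc (-1 : ℝ) 1) (g : H) :
    ∫ x, regression P x * g x ∂P.fst = ∫ z, z.2 * g z.1 ∂P := by
  have hint : Integrable (fun z : 𝒳 × ℝ => z.2 * g z.1) P := by
    refine Integrable.of_bound (measurable_snd.mul
      ((measurable_coe hkm g).comp measurable_fst)).aestronglyMeasurable ‖g‖ ?_
    filter_upwards [hY] with z hz
    rw [norm_mul, ← one_mul ‖g‖]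
    exact mul_le_mul (abs_le.2 hz) (abs_apply_le hk g _) (norm_nonneg _) zero_le_one
  rw [← Measure.integral_condKernel hint]
  simp only [integral_mul_const, regression]

theorem ae_eventually_norm_empAdjoint_sub_le (hY : ∀ᵐ z ∂P, z.2 ∈ Set.Icc (-1 : ℝ) 1)
    (hXY : ∀ i, Measurable fun ω => (X i ω, Y i ω))
    (hlaw : ∀ i, μ.map (fun ω => (X i ω, Y i ω)) = P)
    (hindep : iIndepFun (fun i ω => (X i ω, Y i ω)) μ) :
    ∀ᵐ ω ∂μ, ∀ᶠ n : ℕ in atTop,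
      ‖empAdjoint (fun i : Fin n => X i ω) (fun i : Fin n => Y i ω)
        - (inclusion hkm hk P.fst : H →L[ℝ] _).adjoint ((memLp_regression P hY).toLp _)‖
        ≤ epsN n := by
  -- The concentration bound asks for a norm bound at every point, while `Y` lies in `[-1, 1]` only
  -- almost surely; truncation changes nothing outside a null set.
  set clip : ℝ → ℝ := fun y => max (-1) (min 1 y) with hclip
  have hclipm : Measurable clip := measurable_const.max (measurable_const.min measurable_id)
  have hclip1 : ∀ y, |clip y| ≤ 1 := fun y =>
    abs_le.2 ⟨le_max_left _ _, max_le (by norm_num) (min_le_left _ _)⟩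
  have hclip_eq : ∀ y ∈ Set.Icc (-1 : ℝ) 1, clip y = y := fun y hy => by
    rw [hclip]; simp only [min_eq_right hy.2, max_eq_right hy.1]
  obtain ⟨M, hM, hae⟩ := ae_eventually_norm_mean_sub_le μ P hXY hlaw hindep
    (((weaklyMeasurable_feature hkm).comp measurable_fst).smul (hclipm.comp measurable_snd))
    fun z => by
      rw [norm_smul]
      exact mul_le_one₀ (hclip1 _) (norm_nonneg _) (norm_feature_le hk _)
  have hMeq : (inclusion hkm hk P.fst : H →L[ℝ] _).adjoint ((memLp_regression P hY).toLp _)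
      = M := by
    refine ext_inner_left ℝ fun h => ?_
    rw [real_inner_comm, ContinuousLinearMap.adjoint_inner_left, inner_toLp_inclusion, hM,
      integral_regression_mul hkm hk P hY]
    refine integral_congr_ae ?_
    filter_upwards [hY] with z hz
    simp only [Function.comp_apply, inner_smul_right, inner_feature, hclip_eq _ hz]
  have hYi : ∀ᵐ ω ∂μ, ∀ i, Y i ω ∈ Set.Icc (-1 : ℝ) 1 := by
    refine ae_all_iff.2 fun i => ?_
    rw [← hlaw i] at hY
    exact ae_of_ae_map (hXY i).aemeasurable hY
  filter_upwards [hae, hYi] with ω hω hy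
  filter_upwards [hω] with n hn
  rw [hMeq, empAdjoint]
  simpa only [Function.comp_apply, hclip_eq _ (hy _)] using hn

end Population

end KPLS

theorem mainTheorem3 {𝒳 : Type*} [MeasurableSpace 𝒳]
    {H : Type*} [NormedAddCommGroup H] [InnerProductSpace ℝ H] [CompleteSpace H]
    [RKHS ℝ H 𝒳 ℝ]
    (hk_meas : Measurable fun p : 𝒳 × 𝒳 => KPLS.ker H p.1 p.2)
    (hk_bdd : ∀ x : 𝒳, KPLS.ker H x x ≤ 1)
    (hk_univ : KPLS.IsUniversal (𝒳 := 𝒳) H)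
    (P : Measure (𝒳 × ℝ)) [IsProbabilityMeasure P]
    (hY : ∀ᵐ z ∂P, z.2 ∈ Set.Icc (-1 : ℝ) 1)
    {Ω : Type*} [MeasurableSpace Ω] (μ : Measure Ω) [IsProbabilityMeasure μ]
    (X : ℕ → Ω → 𝒳) (Y : ℕ → Ω → ℝ)
    (hX_meas : ∀ i, Measurable (X i)) (hY_meas : ∀ i, Measurable (Y i))
    (h_law : ∀ i, μ.map (fun ω => (X i ω, Y i ω)) = P)
    (h_indep : iIndepFun (fun i ω => (X i ω, Y i ω)) μ)
    (γ : ℝ) (hγ_pos : 0 < γ) (hγ_lt : γ < 1 / 2) :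
    ∀ᵐ ω ∂μ, Tendsto
      (fun n : ℕ => eLpNorm
        (fun x => KPLS.regression P x -
          KPLS.estimator H γ (fun i : Fin n => X i ω) (fun i : Fin n => Y i ω) x)
        2 P.fst)
      atTop (𝓝 0) := by
  have hXY : ∀ i, Measurable fun ω => (X i ω, Y i ω) := fun i => (hX_meas i).prodMk (hY_meas i)
  have hf := KPLS.memLp_regression P hY
  filter_upwards [KPLS.ae_eventually_norm_empCov_sub_le hk_meas hk_bdd P μ hXY h_law h_indep,
    KPLS.ae_eventually_norm_empAdjoint_sub_le hk_meas hk_bdd P μ hY hXY h_law h_indep]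
    with ω hS hb
  -- From here `ω` is fixed and the argument is deterministic.
  have hlim := KPLS.tendsto_cg_stoppingStep (T := KPLS.inclusion hk_meas hk_bdd P.fst)
    (KPLS.norm_toLp_coe_le hk_meas hk_bdd P.fst)
    (KPLS.denseRange_inclusion hk_meas hk_bdd hk_univ P.fst)
    (fun n => KPLS.norm_empCov_le hk_bdd fun i : Fin n => X i ω) hS hb hγ_pos hγ_lt
    fun n => KPLS.exists_stopsAt_emp _ _ n γ
  have h0 := (hlim.const_sub (hf.toLp _)).enorm
  rw [sub_self, enorm_zero] at h0
  refine h0.congr fun n => ?_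
  rw [KPLS.inclusion_apply, ← MemLp.toLp_sub, Lp.enorm_toLp]
  rfl
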